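/- Let $n\ge 1$, let $M(n)$ be the space of complex $n\times n$ matrices, and put $d(k)=k(k+1)/2$. For $m\le n$ regard $M(m)\subset M(n)$ as the upper left corner (other entries zero); for $x\in M(n)$ let $x_m\in M(m)$ be its upper left $m\times m$ corner, and let $Z_{x,m}\subset M(m)\subset M(n)$ be the associative algebra generated by $x_m$ and the identity $\mathrm{Id}_m$ of $M(m)$. A matrix $y\in M(m)$ is called regular if its centralizer in $M(m)$ has dimension $m$. For $1\le k\le m\le n$ define functions on $M(n)$ by $$\det(\lambda\,\mathrm{Id}_m-x_m)=\lambda^m+\sum_{k=1}^m(-1)^{m-k+1}f_{k,m}(x)\lambda^{k-1},\qquad f_{(k,m)}(x)=\tfrac1{m+1-k}\operatorname{tr}\,(x_m)^{m+1-k}.$$ Call $x$ strongly regular if the differentials at $x$ of all the $d(n)$ functions $f_{k,m}$ are linearly independent. Give $M(n)$ the Poisson structure determined on the coordinate functions $\alpha_{ij}$ by $[\alpha_{ij},\alpha_{st}]=\delta_{js}\alpha_{it}-\delta_{ti}\alpha_{sj}$, and let $\xi_\varphi$ be the Hamiltonian vector field with $\xi_\varphi\psi=[\varphi,\psi]$.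 Let $\mathfrak a$ be the (commutative) Lie algebra of vector fields spanned by the $\xi_{f_{(k,m)}}$, $1\le k\le m\le n$, and let $A$ be the simply connected complex Lie group with Lie algebra $\mathfrak a$, acting on $M(n)$ by integrating the vector fields in $\mathfrak a$. Then every orbit of $A$ is an (immersed) complex submanifold of $M(n)$, the maximal dimension of an $A$-orbit is $d(n-1)$, and for each $x\in M(n)$ the following conditions are equivalent: (a) $x$ is strongly regular; (b) the orbit $A\cdot x$ has the maximal dimension $d(n-1)$; (c) $x_m$ is regular in $M(m)$ for all $1\le m\le n$, and $Z_{x,m}\cap Z_{x,m+1}=0$ for all $1\le m\le n-1$; (d) $\dim Z_{x,m}=m$ for all $1\le m\le n$, and $Z_{x,m}\cap Z_{x,m+1}=0$ for all $1\le m\le n-1$. -/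

import Mathlib

open scoped Matrix.Norms.Operator

namespace GelfandZeitlin

/-- `M n` is the space of complex `n × n` matrices. It is finite dimensional, so that derivatives
do not depend on the norm; the norm in force is the operator norm for the sup norm on `ℂⁿ`. -/
abbrev M (n : ℕ) : Type := Matrix (Fin n) (Fin n) ℂ

/-- `d k = 1 + 2 + ⋯ + k = k (k + 1) / 2`. -/
def d (k : ℕ) : ℕ := k * (k + 1) / 2

/-! ### Cutoffs, regular matrices, the algebras `Z_{x,m}` -/

/-- The cutoff `x_m` : the upper left `m × m` corner of `x`, as an element of `M m`. -/
def cutoff {m n : ℕ} (h : m ≤ n) (x : M n) : M m :=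
  x.submatrix (Fin.castLE h) (Fin.castLE h)

/-- The inclusion of `M m` into `M n` as the upper left corner, filled up with zeros. -/
def corner {m : ℕ} (n : ℕ) (y : M m) : M n :=
  Matrix.of fun i j => if h : (i : ℕ) < m ∧ (j : ℕ) < m then y ⟨i, h.1⟩ ⟨j, h.2⟩ else 0

/-- A matrix in `M m` is regular if its centralizer in `M m` has dimension `m`. -/
def IsRegularMatrix {m : ℕ} (y : M m) : Prop :=
  Module.finrank ℂ (Subalgebra.centralizer ℂ ({y} : Set (M m))) = m

/-- `Z_{x,m}` : the associative subalgebra of `M m ⊆ M n` generated by `x_m` and the identity of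
`M m`. (That identity is not the identity of `M n`, hence a non-unital subalgebra of `M n`.) -/
def Z {m n : ℕ} (h : m ≤ n) (x : M n) : NonUnitalSubalgebra ℂ (M n) :=
  NonUnitalAlgebra.adjoin ℂ {corner n (1 : M m), corner n (cutoff h x)}

/-! ### The Gelfand–Zeitlin functions -/

/-- The function `f_{k+1,m}` on `M n` (here `k` runs from `0` to `m - 1`), defined by
`det (λ - x_m) = λ ^ m + ∑ k, (-1) ^ (m - k) f_{k+1,m}(x) λ ^ k`: it is the elementary symmetric
polynomial of degree `m - k` in the eigenvalues of `x_m`. -/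
noncomputable def gzFun {m n : ℕ} (h : m ≤ n) (k : Fin m) (x : M n) : ℂ :=
  (-1) ^ (m - (k : ℕ)) * (cutoff h x).charpoly.coeff k

/-- `x` is strongly regular if the differentials at `x` of all `d n` functions `f_{k,m}`,
`1 ≤ k ≤ m ≤ n`, are linearly independent. The index `⟨m, k⟩` stands for `f_{k+1,m+1}`. -/
def IsStronglyRegular {n : ℕ} (x : M n) : Prop :=
  LinearIndependent ℂ (fun i : (m : Fin n) × Fin ((m : ℕ) + 1) =>
    fderiv ℂ (gzFun (Nat.succ_le_of_lt i.1.isLt) i.2 : M n → ℂ) x)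

/-- The function `f_{(k+1,m)}(x) = (m - k)⁻¹ tr (x_m ^ (m - k))`, `k = 0, …, m - 1`. -/
noncomputable def gzTrace {m n : ℕ} (h : m ≤ n) (k : Fin m) (x : M n) : ℂ :=
  ((m - (k : ℕ) : ℕ) : ℂ)⁻¹ * ((cutoff h x) ^ (m - (k : ℕ))).trace

/-! ### Poisson structure and Hamiltonian vector fields -/

/-- The Poisson bracket of two holomorphic functions on `M n`. It is the biderivation whose values
on the coordinate functions `α_{ij}` are the structure constants of the matrix units:
`[α_{ij}, α_{st}] = δ_{js} α_{it} - δ_{ti} α_{sj}`. -/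
noncomputable def poisson {n : ℕ} (φ ψ : M n → ℂ) (x : M n) : ℂ :=
  ∑ i, ∑ j, ∑ s, ∑ t,
    fderiv ℂ φ x (Matrix.single i j 1) * fderiv ℂ ψ x (Matrix.single s t 1) *
      ((if j = s then x i t else 0) - (if t = i then x s j else 0))

/-- The Hamiltonian vector field `ξ_φ`, i.e. the one with `ξ_φ ψ = [φ, ψ]`. A vector field on the
vector space `M n` is a map `M n → M n`, and its `(s, t)` entry is its action on `α_{st}`. -/
noncomputable def hamiltonianField {n : ℕ} (φ : M n → ℂ) (x : M n) : M n :=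
  Matrix.of fun s t => poisson φ (fun y => y s t) x

/-- The Lie algebra `𝔞` of vector fields, spanned by the Hamiltonian vector fields of all the
functions `f_{(k,m)}`, `1 ≤ k ≤ m ≤ n`. (Those with `m = n` vanish.) -/
noncomputable def gzFields (n : ℕ) : Submodule ℂ (M n → M n) :=
  Submodule.span ℂ {ξ | ∃ (m : ℕ) (h : m ≤ n) (k : Fin m), ξ = hamiltonianField (gzTrace h k)}

/-! ### The group `A` and its orbits -/

/-- `σ` is the time-one map `exp ξ` of the complex flow of the vector field `ξ` : through every
point there is a holomorphic integral curve of `ξ` that is defined on all of `ℂ`, and `σ` moves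
the point at time `0` to the point at time `1`. -/
def IsTimeOneMap {n : ℕ} (ξ : M n → M n) (σ : Equiv.Perm (M n)) : Prop :=
  ∀ y : M n, ∃ γ : ℂ → M n, (∀ t, HasDerivAt γ (ξ (γ t)) t) ∧ γ 0 = y ∧ γ 1 = σ y

/-- The group of transformations of `M n` by which `A` acts, `A` being the simply connected complex
Lie group with Lie algebra `𝔞` that acts on `M n` by integrating the vector fields in `𝔞`. It is
generated by the time-one maps of the fields in `𝔞`, because `A` is generated by `exp 𝔞`. -/
def gzGroup (n : ℕ) : Subgroup (Equiv.Perm (M n)) :=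
  Subgroup.closure {σ | ∃ ξ ∈ gzFields n, IsTimeOneMap ξ σ}

/-- The orbit `A · x`. -/
def gzOrbit {n : ℕ} (x : M n) : Set (M n) := MulAction.orbit (gzGroup n) x

/-- `S` is a complex (immersed) submanifold of dimension `r` of the complex normed space `E` : it is
the image of an injective map `f : N → E`, where the second countable space `N` is covered by
charts with values in `ℂ ^ r` in which `f` is a holomorphic immersion. (Changes of charts are then
holomorphic, and `N` is Hausdorff, because `f` is an injective immersion in every chart.) -/
def IsComplexSubmanifold.{u} {E : Type u} [NormedAddCommGroup E] [NormedSpace ℂ E]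
    (S : Set E) (r : ℕ) : Prop :=
  ∃ (N : Type u) (_ : TopologicalSpace N) (_ : SecondCountableTopology N) (f : N → E),
    Function.Injective f ∧ Set.range f = S ∧
      ∀ p : N, ∃ e : OpenPartialHomeomorph (Fin r → ℂ) N, p ∈ e.target ∧
        DifferentiableOn ℂ (f ∘ e) e.source ∧
        ∀ u ∈ e.source, Function.Injective (fderiv ℂ (f ∘ e) u)

end GelfandZeitlin

open GelfandZeitlin

/-!
Write `z_{m,q}` for the power `x_m ^ q` in the corner `M m`, viewed in `M n`; it is
`cutPow (proj n m) q x`. The gradient of `f_{(k,m)}` for the trace form is `z_{m,m-k}`, so the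
Hamiltonian field of `f_{(k,m)}` is `x ↦ [z_{m,m-k}, x]`, and its flow is conjugation by
`exp (t z_{m,m-k})`. These flows are complete, holomorphic and commute, because conjugation by an
element of a smaller corner commutes with forming the powers of a larger one, while conjugation by
`exp (t z_{m,q})` does not move `x_m` at all. Hence they form an action of a vector space
(`exists_gzAction`), and `gzGroup n` is the group of the transformations of that action, because
an integral curve is unique (`HolomorphicAction.eq_of_hasDerivAt`). An orbit is the injective image
of the quotient of the vector space by a stabilizer, and this is an immersion of a manifold
of dimension `dim span {[z_{m,q}, x]}` (`HolomorphicAction.isComplexSubmanifold_range`). No other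
dimension is possible for the same subset, because the dimension is half of the Hausdorff dimension
(`IsComplexSubmanifold.dimH_eq`).

What remains is linear algebra. Let `S_k`, written `sSpan k x`, be the sum of the spaces
`Z_{x,m}`, `m ≤ k`; its dimension is at most `d k`.

* Up to a unitriangular change of basis and the trace form, the differentials of the functions
  `f_{k,m}` at `x` are the matrices `z_{m,q}`. So strong regularity means `dim S_n = d n`
  (`isStronglyRegular_iff`).
* By the structure theorem for modules over `ℂ[X]`, a matrix is regular if and only if its powers
  span a space of the maximal dimension, and then only the polynomials in it commute with it
  (`isRegularMatrix_iff`, `IsRegularMatrix.mem_adjoin`).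
* An element of `S_k ∩ Z_{x,k+1}` commutes with `x_k`, so that it is in `Z_{x,k}` if `x_k` is
  regular. By induction on `k`, `dim S_n = d n` is equivalent to the conditions on the `Z_{x,m}`
  (`finrank_sSpan_eq_iff`).
* `dim [S_n, x] = d (n - 1)` is also equivalent to `dim S_n = d n` (`finrank_map_bracket_eq_iff`).
  The regularity of `x` itself follows because the functions `f_{(k,m)}` Poisson commute, which
  makes the orbit isotropic in the adjoint orbit of `x`.

The maximal dimension is attained at the nilpotent shift matrix (`finrank_sSpan_shift`).
-/

/-! ### Holomorphic maps of several variables -/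

namespace GelfandZeitlin

open Set Metric Filter Topology Module
open scoped NNReal ENNReal

section Holomorphic

variable {E F : Type*} [NormedAddCommGroup E] [NormedSpace ℂ E] [NormedAddCommGroup F]
  [NormedSpace ℂ F]

/-- A holomorphic map of several variables is strictly differentiable. The Schwarz lemma shows that
it is locally Lipschitz and then, applied to the differences `f (z + a) - f z`, that its derivative
is continuous. -/
theorem hasStrictFDerivAt_of_differentiableOn {f : E → F} {U : Set E} (hU : IsOpen U)
    (hf : DifferentiableOn ℂ f U) {u : E} (hu : u ∈ U) :
    HasStrictFDerivAt f (fderiv ℂ f u) u := by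
  have hev : ∀ᶠ y in 𝓝 u, HasFDerivAt f (fderiv ℂ f y) y := by
    filter_upwards [hU.mem_nhds hu] with y hy
    exact (hf.differentiableAt (hU.mem_nhds hy)).hasFDerivAt
  refine hasStrictFDerivAt_of_hasFDerivAt_of_continuousAt hev ?_
  -- a ball around `u` of radius `2 * R` inside `U` on which `f` is bounded
  have hcont : ContinuousAt f u := hf.continuousOn.continuousAt (hU.mem_nhds hu)
  obtain ⟨ρ, hρ, hball⟩ : ∃ ρ > 0, ∀ z ∈ ball u ρ, z ∈ U ∧ dist (f z) (f u) < 1 := by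
    have hU' : ∀ᶠ z in 𝓝 u, z ∈ U := hU.mem_nhds hu
    exact Metric.eventually_nhds_iff_ball.1 (hU'.and (Metric.tendsto_nhds.1 hcont 1 one_pos))
  obtain ⟨R, rfl⟩ : ∃ R, ρ = 2 * R := ⟨ρ / 2, by ring⟩
  have hR : 0 < R := by linarith
  -- by the Schwarz lemma `f` is Lipschitz near `u`
  have hlip : ∀ c ∈ ball u R, ∀ z ∈ ball c R, dist (f z) (f c) ≤ 2 / R * dist z c := by
    intro c hc z hz
    have hsub : ball c R ⊆ ball u (2 * R) := by
      intro w hw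
      rw [mem_ball] at *
      linarith [dist_triangle w c u]
    refine Complex.dist_le_div_mul_dist_of_mapsTo_ball
      (hf.mono fun w hw => (hball w (hsub hw)).1) (fun w hw => ?_) hz
    have h1 := (hball w (hsub hw)).2
    have h2 := (hball c (hsub (mem_ball_self hR))).2
    rw [mem_closedBall]
    linarith [dist_triangle_right (f w) (f c) (f u)]
  -- by the Schwarz lemma again, now for the differences, the derivative is Lipschitz at `u`
  have key : ∀ w ∈ ball u (R / 2),
      ‖fderiv ℂ f w - fderiv ℂ f u‖ ≤ (2 * (2 / R * dist w u)) / (R / 2) := by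
    intro w hw
    have hsub1 : ∀ z ∈ ball u (R / 2), z + (w - u) ∈ ball u (2 * R) ∧ z ∈ ball u (2 * R) := by
      intro z hz
      rw [mem_ball_iff_norm] at *
      refine ⟨?_, mem_ball_iff_norm.2 (by linarith)⟩
      rw [show z + (w - u) - u = (z - u) + (w - u) by abel]
      linarith [norm_add_le (z - u) (w - u)]
    have hd1 : ∀ z ∈ ball u (R / 2), DifferentiableAt ℂ f (z + (w - u)) := fun z hz =>
      hf.differentiableAt (hU.mem_nhds (hball _ (hsub1 z hz).1).1)
    have hd2 : ∀ z ∈ ball u (R / 2), DifferentiableAt ℂ f z := fun z hz =>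
      hf.differentiableAt (hU.mem_nhds (hball _ (hsub1 z hz).2).1)
    have hbd : ∀ z ∈ ball u (R / 2), ‖f (z + (w - u)) - f z‖ ≤ 2 / R * dist w u := by
      intro z hz
      rw [← dist_eq_norm]
      have hz' : z ∈ ball u R := by rw [mem_ball] at *; linarith
      have h0 : dist (z + (w - u)) z = dist w u := by simp [dist_eq_norm]
      refine (hlip z hz' _ ?_).trans_eq (by rw [h0])
      rw [mem_ball, h0]
      rw [mem_ball] at hw
      linarith
    have hu0 : u ∈ ball u (R / 2) := mem_ball_self (by linarith)
    have := Complex.norm_fderiv_le_div_of_mapsTo_ball (f := fun z => f (z + (w - u)) - f z)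
      (c := u) (R₁ := R / 2) (R₂ := 2 * (2 / R * dist w u))
      (fun z hz => (((hd1 z hz).comp z (by fun_prop)).sub (hd2 z hz)).differentiableWithinAt)
      (fun z hz => by
        rw [mem_closedBall]
        have h1 := hbd z hz
        have h2 := hbd u hu0
        have h3 := norm_sub_le (f (z + (w - u)) - f z) (f (u + (w - u)) - f u)
        rw [dist_eq_norm]
        linarith) (by linarith)
    have h1 := hd1 u hu0
    have h2 : fderiv ℂ (fun z => f (z + (w - u)) - f z) u =
        fderiv ℂ (fun z => f (z + (w - u))) u - fderiv ℂ f u :=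
      fderiv_fun_sub (h1.comp u (f := fun z => z + (w - u)) (by fun_prop)) (hd2 u hu0)
    rw [h2, fderiv_comp_add_right] at this
    simpa using this
  rw [ContinuousAt, tendsto_iff_norm_sub_tendsto_zero]
  refine squeeze_zero' (Eventually.of_forall fun _ => norm_nonneg _)
    (eventually_of_mem (ball_mem_nhds u (by linarith : 0 < R / 2)) key) ?_
  have : Continuous fun w => (2 * (2 / R * dist w u)) / (R / 2) := by fun_prop
  simpa using this.tendsto u

/-- A holomorphic map is bi-Lipschitz near a point where its derivative is injective; this is the
lower bound. -/
theorem exists_antilipschitz_of_differentiableOn [FiniteDimensional ℂ E] {f : E → F}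
    {U : Set E} (hU : IsOpen U) (hf : DifferentiableOn ℂ f U) {u : E} (hu : u ∈ U)
    (hinj : Function.Injective (fderiv ℂ f u)) :
    ∃ V ∈ 𝓝 u, ∃ K : ℝ≥0, ∀ a ∈ V, ∀ b ∈ V, dist a b ≤ K * dist (f a) (f b) := by
  obtain ⟨K, hK, hanti⟩ := (fderiv ℂ f u : E →ₗ[ℂ] F).exists_antilipschitzWith
    (LinearMap.ker_eq_bot.2 hinj)
  have hc : 0 < (K : ℝ≥0)⁻¹ / 2 := by positivity
  obtain ⟨V, hV, happ⟩ := (hasStrictFDerivAt_of_differentiableOn hU hf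
    hu).approximates_deriv_on_nhds (c := K⁻¹ / 2) (Or.inr hc)
  refine ⟨V, hV, 2 * K, fun a ha b hb => ?_⟩
  have h1 := happ a ha b hb
  have h2 := hanti.le_mul_dist a b
  simp only [ContinuousLinearMap.coe_coe, dist_eq_norm, ← map_sub] at h2
  simp only [dist_eq_norm]
  have h3 : ‖fderiv ℂ f u (a - b)‖ ≤ ‖f a - f b‖ + ‖f a - f b - fderiv ℂ f u (a - b)‖ := by
    have := norm_sub_le (f a - f b) (f a - f b - fderiv ℂ f u (a - b))
    simpa using this
  have hK' : (0 : ℝ) < K := hK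
  push_cast at h1 ⊢
  have h4 : ‖a - b‖ ≤ K * (‖f a - f b‖ + (K : ℝ)⁻¹ / 2 * ‖a - b‖) :=
    h2.trans (by gcongr; linarith)
  have h5 : (K : ℝ) * ((K : ℝ)⁻¹ / 2 * ‖a - b‖) = ‖a - b‖ / 2 := by
    field_simp
  rw [mul_add, h5] at h4
  linarith

end Holomorphic

/-! ### The dimension of an immersed submanifold -/

section Dimension

variable {F : Type*} [NormedAddCommGroup F] [NormedSpace ℂ F]

theorem finrank_real_pi_complex (r : ℕ) : finrank ℝ (Fin r → ℂ) = 2 * r := by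
  rw [finrank_pi_fintype]
  simp [Complex.finrank_real_complex, mul_comm]

theorem dimH_image_of_immersion {r : ℕ} {f : (Fin r → ℂ) → F} {U : Set (Fin r → ℂ)}
    (hU : IsOpen U) (hne : U.Nonempty) (hf : DifferentiableOn ℂ f U)
    (hinj : ∀ u ∈ U, Function.Injective (fderiv ℂ f u)) :
    dimH (f '' U) = (2 * r : ℕ) := by
  rw [← finrank_real_pi_complex]
  apply le_antisymm
  · refine (dimH_image_le_of_locally_lipschitzOn fun u hu => ?_).trans
      (Real.dimH_of_nonempty_interior (by rwa [hU.interior_eq])).le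
    obtain ⟨K, V, hV, h⟩ := (hasStrictFDerivAt_of_differentiableOn hU hf hu).exists_lipschitzOnWith
    exact ⟨K, V, mem_nhdsWithin_of_mem_nhds hV, h⟩
  · obtain ⟨u, hu⟩ := hne
    obtain ⟨V, hV, K, h⟩ := exists_antilipschitz_of_differentiableOn hU hf hu (hinj u hu)
    have hW : V ∩ U ∈ 𝓝 u := inter_mem hV (hU.mem_nhds hu)
    rw [← Real.dimH_of_mem_nhds hW]
    have hanti : AntilipschitzWith K ((V ∩ U).domRestrict f) :=
      AntilipschitzWith.of_le_mul_dist fun a b => h a a.2.1 b b.2.1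
    have h1 := hanti.le_dimH_image univ
    have h2 : dimH ((↑) '' (univ : Set (V ∩ U : Set (Fin r → ℂ))) : Set (Fin r → ℂ)) =
        dimH (univ : Set (V ∩ U : Set (Fin r → ℂ))) := isometry_subtype_coe.dimH_image _
    rw [image_univ, Subtype.range_coe] at h2
    rw [h2]
    refine h1.trans (dimH_mono ?_)
    rintro _ ⟨a, -, rfl⟩
    exact ⟨a, a.2.2, rfl⟩

/-- The second countability of the manifold enters here: a countable union of sets of Hausdorff
dimension `2 * r` has Hausdorff dimension `2 * r`. -/
theorem IsComplexSubmanifold.dimH_eq {S : Set F} {r : ℕ} (h : IsComplexSubmanifold S r)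
    (hS : S.Nonempty) : dimH S = (2 * r : ℕ) := by
  obtain ⟨N, _, _, f, -, rfl, hch⟩ := h
  choose e he hd hi using hch
  obtain ⟨T, hT, hcov⟩ := TopologicalSpace.countable_cover_nhds
    fun p => (e p).open_target.mem_nhds (he p)
  have hne : T.Nonempty := by
    obtain ⟨_, p, rfl⟩ := hS
    have : p ∈ ⋃ x ∈ T, (e x).target := hcov ▸ mem_univ p
    simp only [mem_iUnion] at this
    exact ⟨_, this.choose_spec.choose⟩
  have hdim : ∀ p, dimH (f '' (e p).target) = (2 * r : ℕ) := fun p => by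
    rw [← (e p).image_source_eq_target, ← image_comp]
    exact dimH_image_of_immersion (e p).open_source
      ⟨(e p).symm p, (e p).map_target (he p)⟩ (hd p) (hi p)
  rw [← image_univ, ← hcov, image_iUnion₂, dimH_bUnion hT]
  simp only [hdim]
  exact biSup_const hne

theorem IsComplexSubmanifold.dim_unique {S : Set F} {r s : ℕ} (hr : IsComplexSubmanifold S r)
    (hs : IsComplexSubmanifold S s) (hS : S.Nonempty) : r = s := by
  have h := (hr.dimH_eq hS).symm.trans (hs.dimH_eq hS)
  have h' : 2 * r = 2 * s := by exact_mod_cast h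
  omega

end Dimension

end GelfandZeitlin

/-! ### Holomorphic actions of a vector space -/

namespace GelfandZeitlin

open Set Metric Filter Topology Module

universe u

/-- A holomorphic action of the additive group of the vector space `V` on `E`. The generating
vector fields are recorded as well: `field x` is the differential at `0` of `a ↦ act a x`. -/
structure HolomorphicAction (V E : Type u) [NormedAddCommGroup V] [NormedSpace ℂ V]
    [NormedAddCommGroup E] [NormedSpace ℂ E] where
  /-- The transformation of `E` by which a vector acts. -/
  act : V → E → E
  /-- The vector fields that generate the action. -/
  field : E → V →L[ℂ] E
  differentiable : Differentiable ℂ fun p : V × E => act p.1 p.2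
  act_zero : ∀ x, act 0 x = x
  act_add : ∀ a b x, act (a + b) x = act a (act b x)
  hasFDerivAt_zero : ∀ x, HasFDerivAt (fun a => act a x) (field x) 0

namespace HolomorphicAction

variable {V E : Type u} [NormedAddCommGroup V] [NormedSpace ℂ V] [NormedAddCommGroup E]
  [NormedSpace ℂ E] (Φ : HolomorphicAction V E)

theorem act_neg_act (a : V) (x : E) : Φ.act (-a) (Φ.act a x) = x := by
  rw [← Φ.act_add, neg_add_cancel, Φ.act_zero]

theorem act_act_neg (a : V) (x : E) : Φ.act a (Φ.act (-a) x) = x := by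
  rw [← Φ.act_add, add_neg_cancel, Φ.act_zero]

theorem act_injective (a : V) : Function.Injective (Φ.act a) :=
  Function.LeftInverse.injective (Φ.act_neg_act a)

theorem act_comm (a b : V) (x : E) : Φ.act a (Φ.act b x) = Φ.act b (Φ.act a x) := by
  rw [← Φ.act_add, ← Φ.act_add, add_comm]

/-- The transformation by which a vector acts, as a permutation. -/
@[simps]
def perm (a : V) : Equiv.Perm E where
  toFun := Φ.act a
  invFun := Φ.act (-a)
  left_inv := Φ.act_neg_act a
  right_inv := Φ.act_act_neg a

theorem hasFDerivAt (a : V) (x : E) :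
    HasFDerivAt (fun b => Φ.act b x) (Φ.field (Φ.act a x)) a := by
  have h : (fun b => Φ.act b x) = (fun b => Φ.act b (Φ.act a x)) ∘ fun b => b - a := by
    funext b
    simp [← Φ.act_add]
  rw [h]
  have h0 := Φ.hasFDerivAt_zero (Φ.act a x)
  rw [← sub_self a] at h0
  have h1 : HasFDerivAt (fun b => b - a) (ContinuousLinearMap.id ℂ V) a :=
    (hasFDerivAt_id a).sub_const a
  exact HasFDerivAt.comp a (f := fun b => b - a) h0 h1

theorem hasDerivAt_smul (a : V) (x : E) (t : ℂ) :
    HasDerivAt (fun s : ℂ => Φ.act (s • a) x) (Φ.field (Φ.act (t • a) x) a) t := by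
  have h1 : HasDerivAt (fun s : ℂ => s • a) a t := by
    simpa using (hasDerivAt_id t).smul_const a
  exact (Φ.hasFDerivAt (t • a) x).comp_hasDerivAt t h1

theorem differentiableAt_act (a : V) (x : E) : DifferentiableAt ℂ (Φ.act a) x :=
  (Φ.differentiable (a, x)).comp x (f := fun y => (a, y)) (by fun_prop)

theorem fderiv_uncurry (a : V) (x : E) (v : V) (w : E) :
    fderiv ℂ (fun p : V × E => Φ.act p.1 p.2) (a, x) (v, w) =
      Φ.field (Φ.act a x) v + fderiv ℂ (Φ.act a) x w := by
  have hD := (Φ.differentiable (a, x)).hasFDerivAt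
  have h1 := (hD.comp a (f := fun b => (b, x)) (hasFDerivAt_prodMk_left a x)).unique
    (Φ.hasFDerivAt a x)
  have h2 := (hD.comp x (f := fun y => (a, y)) (hasFDerivAt_prodMk_right a x)).unique
    (Φ.differentiableAt_act a x).hasFDerivAt
  rw [← h1, ← h2, ContinuousLinearMap.comp_apply, ContinuousLinearMap.comp_apply, ← map_add]
  simp

/-- The generating vector fields are invariant under the action. -/
theorem fderiv_act_field (a b : V) (x : E) :
    fderiv ℂ (Φ.act a) x (Φ.field x b) = Φ.field (Φ.act a x) b := by
  have h1 := Φ.hasDerivAt_smul b x 0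
  have h2 := Φ.hasDerivAt_smul b (Φ.act a x) 0
  rw [zero_smul, Φ.act_zero] at h1 h2
  have h3 := ((by simpa [Φ.act_zero] using (Φ.differentiableAt_act a x).hasFDerivAt :
    HasFDerivAt (Φ.act a) (fderiv ℂ (Φ.act a) x) (Φ.act ((0 : ℂ) • b) x))).comp_hasDerivAt 0 h1
  refine h3.unique (h2.congr_of_eventuallyEq (Eventually.of_forall fun s => ?_))
  exact Φ.act_comm _ _ _

/-- An integral curve of a generating vector field is an orbit of its one-parameter group:
transported back along the action it has derivative zero. -/
theorem eq_of_hasDerivAt {γ : ℂ → E} {a : V} (hγ : ∀ t, HasDerivAt γ (Φ.field (γ t) a) t)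
    (t : ℂ) : γ t = Φ.act (t • a) (γ 0) := by
  have key : ∀ s, HasDerivAt (fun s : ℂ => Φ.act (-(s • a)) (γ s)) 0 s := by
    intro s
    have hD := (Φ.differentiable (-(s • a), γ s)).hasFDerivAt
    set D := fderiv ℂ (fun p : V × E => Φ.act p.1 p.2) (-(s • a), γ s)
    have h1 : HasDerivAt (fun s : ℂ => -(s • a)) (-a) s := by
      simpa using ((hasDerivAt_id s).smul_const a).fun_neg
    have h2 := hD.comp_hasDerivAt s (h1.prodMk (hγ s))
    have h5 : D (-a, Φ.field (γ s) a) = 0 := by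
      rw [Φ.fderiv_uncurry, fderiv_act_field, map_neg, neg_add_cancel]
    rw [h5] at h2
    exact h2
  have := is_const_of_deriv_eq_zero (fun s => (key s).differentiableAt)
    (fun s => (key s).deriv) t 0
  simp only [zero_smul, neg_zero, Φ.act_zero] at this
  rw [← this, Φ.act_act_neg]

/-- A point where a generating vector field vanishes is fixed by its one-parameter group. -/
theorem act_eq_of_field_eq_zero {a : V} {x : E} (h : Φ.field x a = 0) : Φ.act a x = x := by
  have := Φ.eq_of_hasDerivAt (γ := fun _ => x) (a := a) (fun t => by
    rw [h]; exact hasDerivAt_const t x) 1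
  simpa using this.symm

theorem field_act_eq_zero_iff {a b : V} {x : E} :
    Φ.field (Φ.act b x) a = 0 ↔ Φ.field x a = 0 := by
  constructor
  · intro h
    have h1 := Φ.fderiv_act_field (-b) a (Φ.act b x)
    rw [Φ.act_neg_act, h, map_zero] at h1
    exact h1.symm
  · intro h
    rw [← Φ.fderiv_act_field, h, map_zero]

/-- The stabilizer of a point, as a subgroup of the acting vector space. -/
def stabilizer (x : E) : AddSubgroup V where
  carrier := {a | Φ.act a x = x}
  zero_mem' := Φ.act_zero x
  add_mem' := fun {a b} ha hb => by
    rw [mem_ofPred_eq] at *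
    rw [Φ.act_add, hb, ha]
  neg_mem' := fun {a} ha => by
    rw [mem_ofPred_eq] at *
    nth_rw 1 [← ha]
    rw [Φ.act_neg_act]

theorem mem_stabilizer {a : V} {x : E} : a ∈ Φ.stabilizer x ↔ Φ.act a x = x := Iff.rfl

theorem act_eq_act_iff {a b : V} {x : E} :
    Φ.act a x = Φ.act b x ↔ -a + b ∈ Φ.stabilizer x := by
  rw [mem_stabilizer, Φ.act_add]
  constructor
  · intro h
    rw [← h, Φ.act_neg_act]
  · intro h
    rw [← Φ.act_injective (-a) (h.trans (Φ.act_neg_act a x).symm)]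

/-- The orbits of a holomorphic action of a vector space are immersed submanifolds: the orbit
of `x` is the image of the quotient of `V` by the stabilizer of `x`, and near any point the
quotient looks like a linear complement of the kernel of `field x`. -/
theorem isComplexSubmanifold_range [FiniteDimensional ℂ V] (x : E) :
    IsComplexSubmanifold (range fun a => Φ.act a x)
      (finrank ℂ (LinearMap.range (Φ.field x : V →ₗ[ℂ] E))) := by
  set L : V →ₗ[ℂ] E := (Φ.field x : V →ₗ[ℂ] E) with hL
  set r := finrank ℂ (LinearMap.range L)
  have hsc : SecondCountableTopology V :=
    have := FiniteDimensional.proper ℂ V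
    secondCountable_of_proper
  -- the differential of the orbit map, with its image identified with `ℂ ^ r`, and a section of it
  let π : V →ₗ[ℂ] (Fin r → ℂ) :=
    (LinearEquiv.ofFinrankEq (LinearMap.range L) (Fin r → ℂ) (by simp [r])).toLinearMap ∘ₗ
      L.rangeRestrict
  have hπker : ∀ v, π v = 0 ↔ Φ.field x v = 0 := by
    intro v
    simp only [π, LinearMap.comp_apply, LinearEquiv.coe_coe, LinearEquiv.map_eq_zero_iff]
    rw [← Subtype.coe_inj]
    rfl
  obtain ⟨s, hs⟩ := π.exists_rightInverse_of_surjective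
    (LinearMap.range_eq_top.2 ((LinearEquiv.surjective _).comp L.surjective_rangeRestrict))
  have hs' : ∀ w, π (s w) = w := fun w => DFunLike.congr_fun hs w
  have hπc : Continuous π := π.continuous_of_finiteDimensional
  let sL : (Fin r → ℂ) →L[ℂ] V := LinearMap.toContinuousLinearMap s
  have hsL : ∀ w, sL w = s w := fun _ => rfl
  let N := V ⧸ Φ.stabilizer x
  let f : N → E := Quotient.lift (fun a => Φ.act a x) fun a b hab =>
    Φ.act_eq_act_iff.2 (QuotientAddGroup.leftRel_apply.1 hab)
  have hf : ∀ a : V, f (QuotientAddGroup.mk a) = Φ.act a x := fun _ => rfl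
  have hder : ∀ (a : V) (w : Fin r → ℂ), HasFDerivAt (fun w => Φ.act (a + sL w) x)
      ((Φ.field (Φ.act (a + sL w) x)).comp sL) w := fun a w => by
    have h1 : HasFDerivAt (fun w => a + sL w) sL w := sL.hasFDerivAt.const_add a
    exact (Φ.hasFDerivAt (a + sL w) x).comp w h1
  have hinj : ∀ (a : V) (w : Fin r → ℂ),
      Function.Injective ((Φ.field (Φ.act (a + sL w) x)).comp sL) := fun a w => by
    rw [injective_iff_map_eq_zero]
    intro v hv
    rw [ContinuousLinearMap.comp_apply, field_act_eq_zero_iff, ← hπker, hsL, hs'] at hv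
    exact hv
  -- the radius of the charts is the same everywhere, by homogeneity
  obtain ⟨U, hUo, hU0, hUinj⟩ : ∃ U : Set (Fin r → ℂ), IsOpen U ∧ 0 ∈ U ∧
      InjOn (fun w => Φ.act (sL w) x) U := by
    obtain ⟨U, hU, K, hK⟩ := exists_antilipschitz_of_differentiableOn isOpen_univ
      (f := fun w => Φ.act (0 + sL w) x) (u := 0)
      (fun w _ => (hder 0 w).differentiableAt.differentiableWithinAt) (mem_univ _)
      (by rw [(hder 0 0).fderiv]; exact hinj 0 0)
    obtain ⟨U', hU', ho, h0⟩ := _root_.mem_nhds_iff.1 hU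
    refine ⟨U', ho, h0, fun a ha b hb hab => ?_⟩
    have := hK a (hU' ha) b (hU' hb)
    simp only [zero_add] at this hab
    rw [hab, dist_self, mul_zero] at this
    exact dist_le_zero.1 this
  refine ⟨N, inferInstance, inferInstance, f, ?_, ?_, ?_⟩
  · intro p q
    induction p using QuotientAddGroup.induction_on with | H a => ?_
    induction q using QuotientAddGroup.induction_on with | H b => ?_
    intro h
    exact QuotientAddGroup.eq.2 (Φ.act_eq_act_iff.1 h)
  · ext y
    constructor
    · rintro ⟨p, rfl⟩
      induction p using QuotientAddGroup.induction_on with | H a => ?_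
      exact ⟨a, rfl⟩
    · rintro ⟨a, rfl⟩
      exact ⟨QuotientAddGroup.mk a, rfl⟩
  · intro p
    induction p using QuotientAddGroup.induction_on with | H a => ?_
    let g : (Fin r → ℂ) → N := fun w => QuotientAddGroup.mk (a + sL w)
    have hgU : InjOn g U := by
      intro w hw w' hw' h
      have h1 := congrArg f h
      simp only [g, hf, Φ.act_add] at h1
      exact hUinj hw hw' (Φ.act_injective a h1)
    have hgc : Continuous g := QuotientAddGroup.continuous_mk.comp (by fun_prop)
    have hgo : IsOpenMap g := by
      intro O hO
      have : g '' O = QuotientAddGroup.mk '' {v : V | π (v - a) ∈ O} := by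
        ext q
        constructor
        · rintro ⟨w, hw, rfl⟩
          exact ⟨a + sL w, by simpa [hsL, hs'] using hw, rfl⟩
        · rintro ⟨v, hv, rfl⟩
          refine ⟨π (v - a), hv, QuotientAddGroup.eq.2 ?_⟩
          apply Φ.act_eq_of_field_eq_zero
          rw [← hπker, map_add, map_neg, map_add, hsL, hs', map_sub]
          abel
      rw [this]
      exact QuotientAddGroup.isOpenMap_coe _ (hO.preimage (by fun_prop))
    refine ⟨OpenPartialHomeomorph.ofContinuousOpen (hgU.toPartialEquiv g U) hgc.continuousOn
      hgo hUo, ⟨0, hU0, by simp [g]⟩, ?_, ?_⟩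
    · exact fun w _ => (hder a w).differentiableAt.differentiableWithinAt
    · intro w _
      have := (hder a w).fderiv
      change Function.Injective (fderiv ℂ (fun w => Φ.act (a + sL w) x) w)
      rw [this]
      exact hinj a w

end HolomorphicAction

end GelfandZeitlin

/-! ### Commuting flows -/

namespace GelfandZeitlin

open Set Metric Filter Topology Module

namespace HolomorphicAction

variable {E : Type} [NormedAddCommGroup E] [NormedSpace ℂ E]

/-- Finitely many commuting holomorphic flows combine to an action of `ι → ℂ`. -/
theorem exists_of_commuting {ι : Type} [Fintype ι] (ψ : ι → HolomorphicAction ℂ E)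
    (hψ : ∀ i j s t x, (ψ i).act s ((ψ j).act t x) = (ψ j).act t ((ψ i).act s x)) :
    ∃ Φ : HolomorphicAction (ι → ℂ) E, ∀ x a, Φ.field x a = ∑ i, a i • (ψ i).field x 1 := by
  classical
  let act : List ι → (ι → ℂ) → E → E := fun l a x => l.foldr (fun i y => (ψ i).act (a i) y) x
  have hcons : ∀ i l a x, act (i :: l) a x = (ψ i).act (a i) (act l a x) := fun _ _ _ _ => rfl
  have hdiff : ∀ l, Differentiable ℂ fun p : (ι → ℂ) × E => act l p.1 p.2 := by
    intro l
    induction l with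
    | nil => exact differentiable_snd
    | cons i l ih =>
      have : (fun p : (ι → ℂ) × E => act (i :: l) p.1 p.2) =
          (fun q : ℂ × E => (ψ i).act q.1 q.2) ∘ fun p => (p.1 i, act l p.1 p.2) := rfl
      rw [this]
      exact (ψ i).differentiable.comp ((by fun_prop : Differentiable ℂ
        fun p : (ι → ℂ) × E => p.1 i).prodMk ih)
  have hzero : ∀ l x, act l 0 x = x := by
    intro l x
    induction l with
    | nil => rfl
    | cons i l ih => rw [hcons, ih, Pi.zero_apply, (ψ i).act_zero]
  have hcomm : ∀ l i t a x, act l a ((ψ i).act t x) = (ψ i).act t (act l a x) := by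
    intro l i t a x
    induction l with
    | nil => rfl
    | cons j l ih => rw [hcons, hcons, ih, hψ]
  have hadd : ∀ l a b x, act l (a + b) x = act l a (act l b x) := by
    intro l a b x
    induction l with
    | nil => rfl
    | cons i l ih => rw [hcons, hcons, hcons, ih, hcomm, Pi.add_apply, (ψ i).act_add]
  let field : List ι → E → (ι → ℂ) →L[ℂ] E := fun l x =>
    (l.map fun i => (ContinuousLinearMap.proj i : (ι → ℂ) →L[ℂ] ℂ).smulRight
      ((ψ i).field x 1)).sum
  have hfield : ∀ l x, HasFDerivAt (fun a => act l a x) (field l x) 0 := by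
    intro l x
    induction l with
    | nil => exact hasFDerivAt_const x 0
    | cons i l ih =>
      have h1 := ((ψ i).differentiable (0, x)).hasFDerivAt
      have h2 : HasFDerivAt (fun a : ι → ℂ => a i)
        (ContinuousLinearMap.proj i : (ι → ℂ) →L[ℂ] ℂ) 0 := hasFDerivAt_apply i 0
      have h3 := h2.prodMk ih
      have h4 : ((0 : ℂ), x) = (((0 : ι → ℂ) i), act l 0 x) := by rw [hzero]; rfl
      rw [h4] at h1
      have h5 := HasFDerivAt.comp (0 : ι → ℂ) (f := fun a => (a i, act l a x)) h1 h3
      refine h5.congr_fderiv ?_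
      apply ContinuousLinearMap.ext
      intro a
      have hid : (ψ i).act 0 = id := funext fun y => (ψ i).act_zero y
      rw [← h4, ContinuousLinearMap.comp_apply, ContinuousLinearMap.prod_apply,
        (ψ i).fderiv_uncurry, hid, fderiv_id]
      simp only [field, List.map_cons, List.sum_cons, add_apply, id,
        ContinuousLinearMap.smulRight_apply, ContinuousLinearMap.proj_apply,
        ContinuousLinearMap.id_apply]
      rw [← map_smul, smul_eq_mul, mul_one]
  refine ⟨⟨act Finset.univ.toList, field Finset.univ.toList, hdiff _, hzero _, hadd _,
    hfield _⟩, fun x a => ?_⟩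
  simp only [field]
  rw [Finset.sum_map_toList]
  simp

end HolomorphicAction

/-! ### The flows of the powers of the cutoffs -/

section CutPow

variable {A : Type} [Ring A]

/-- The element `p (p x p) ^ q`. If `p` is the idempotent of `M n` that cuts out the corner
`M m`, then this is the power `x_m ^ q`, formed in `M m` (so that `x_m ^ 0` is `p`). -/
def cutPow (p : A) (q : ℕ) (x : A) : A := p * (p * x * p) ^ q

theorem commute_cut {p : A} (hp : p * p = p) (x : A) : Commute p (p * x * p) := by
  rw [Commute, SemiconjBy, mul_assoc (p * x), hp, ← mul_assoc, ← mul_assoc, hp]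

theorem commute_cutPow {p : A} (hp : p * p = p) (q : ℕ) (x : A) : Commute p (cutPow p q x) :=
  (Commute.refl p).mul_right ((commute_cut hp x).pow_right q)

theorem cut_commute_cutPow {p : A} (hp : p * p = p) (q : ℕ) (x : A) :
    Commute (p * x * p) (cutPow p q x) :=
  (commute_cut hp x).symm.mul_right ((Commute.refl _).pow_right q)

end CutPow

section Flow

open NormedSpace

/-- Conjugation by `exp a`. -/
noncomputable def expConj {A : Type} [NormedRing A] (a x : A) : A := exp a * x * exp (-a)

theorem expConj_zero {A : Type} [NormedRing A] (x : A) : expConj 0 x = x := by simp [expConj]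

variable {A : Type} [NormedRing A] [NormedAlgebra ℂ A]

theorem expConj_smul (a : A) (t : ℂ) (x : A) : expConj a (t • x) = t • expConj a x := by
  simp [expConj]

theorem commute_exp {a b : A} (h : Commute a b) : Commute a (exp b) := by
  have := NormedAlgebra.restrictScalars ℚ ℂ A
  exact h.exp_right

variable [CompleteSpace A]

theorem exp_mul_exp_neg_self (a : A) : exp a * exp (-a) = 1 := by
  have := NormedAlgebra.restrictScalars ℚ ℂ A
  rw [← exp_add_of_commute (Commute.neg_right (Commute.refl a)), add_neg_cancel, exp_zero]

theorem exp_neg_mul_exp_self (a : A) : exp (-a) * exp a = 1 := by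
  simpa using exp_mul_exp_neg_self (-a)

theorem expConj_mul (a x y : A) : expConj a (x * y) = expConj a x * expConj a y := by
  simp only [expConj]
  calc exp a * (x * y) * exp (-a) = exp a * x * 1 * (y * exp (-a)) := by noncomm_ring
    _ = _ := by rw [← exp_neg_mul_exp_self a]; noncomm_ring

theorem expConj_eq_self {a x : A} (h : Commute x a) : expConj a x = x := by
  rw [expConj, ← (commute_exp h).eq, mul_assoc, exp_mul_exp_neg_self, mul_one]

theorem expConj_pow (a x : A) (k : ℕ) : expConj a (x ^ k) = expConj a x ^ k := by
  induction k with
  | zero => simp [expConj_eq_self (Commute.one_left a)]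
  | succ k ih => rw [pow_succ, pow_succ, expConj_mul, ih]

theorem expConj_add {a b : A} (h : Commute a b) (x : A) :
    expConj (a + b) x = expConj a (expConj b x) := by
  have := NormedAlgebra.restrictScalars ℚ ℂ A
  rw [expConj, neg_add_rev, exp_add_of_commute h, exp_add_of_commute h.neg_left.neg_right.symm]
  simp only [expConj]
  noncomm_ring

/-- Conjugation by an exponential commutes with taking exponentials. -/
theorem exp_expConj (a b : A) : exp (expConj a b) = expConj a (exp b) := by
  have := NormedAlgebra.restrictScalars ℚ ℂ A
  let u : Aˣ := ⟨exp a, exp (-a), exp_mul_exp_neg_self a, exp_neg_mul_exp_self a⟩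
  exact exp_units_conj u b

theorem expConj_expConj (a b x : A) :
    expConj (expConj a b) (expConj a x) = expConj a (expConj b x) := by
  have h : -expConj a b = expConj a (-b) := by simp [expConj]
  conv_lhs => rw [expConj, h, exp_expConj, exp_expConj, ← expConj_mul, ← expConj_mul]
  rfl

theorem expConj_cut {p e : A} (hp : p * p = p) {q : ℕ} {x : A} {t : ℂ}
    (he : e = t • cutPow p q x) : p * expConj e x * p = p * x * p := by
  subst he
  have h1 : expConj (t • cutPow p q x) p = p :=
    expConj_eq_self ((commute_cutPow hp q x).smul_right t)
  have h2 : expConj (t • cutPow p q x) (p * x * p) = p * x * p :=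
    expConj_eq_self ((cut_commute_cutPow hp q x).smul_right t)
  nth_rw 1 [← h2]
  rw [expConj_mul, expConj_mul, h1]

/-- Flowing along the power of a larger corner does not change the powers of a smaller one. -/
theorem cutPow_expConj_of_le {p p' : A} (hp' : p' * p' = p') (h : p * p' = p) (h' : p' * p = p)
    (q q' : ℕ) (x : A) (t : ℂ) :
    cutPow p q (expConj (t • cutPow p' q' x) x) = cutPow p q x := by
  have h1 : ∀ y, p * y * p = p * (p' * y * p') * p := fun y => by
    rw [← mul_assoc, ← mul_assoc, h, mul_assoc _ p' p, h']
  rw [cutPow, h1, expConj_cut hp' rfl, ← h1]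
  rfl

/-- Flowing along the power of a smaller corner conjugates the powers of a larger one. -/
theorem cutPow_expConj_of_ge {p p' : A} (h : p * p' = p) (h' : p' * p = p) (hp : p * p = p)
    (q q' : ℕ) (x : A) (t : ℂ) :
    cutPow p' q' (expConj (t • cutPow p q x) x) =
      expConj (t • cutPow p q x) (cutPow p' q' x) := by
  have h1 : Commute p' (cutPow p q x) := by
    have e1 : p' * cutPow p q x = cutPow p q x := by rw [cutPow, ← mul_assoc, h']
    have e2 : cutPow p q x * p' = cutPow p q x := by
      have : cutPow p q x = cutPow p q x * p := by
        rw [← (commute_cutPow hp q x).eq, cutPow, ← mul_assoc, hp]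
      rw [this, mul_assoc, h]
    rw [Commute, SemiconjBy, e1, e2]
  have h2 : expConj (t • cutPow p q x) p' = p' := expConj_eq_self (h1.smul_right t)
  simp only [cutPow, expConj_mul, expConj_pow] at *
  rw [h2]

/-- The flow of the vector field `x ↦ [p (p x p) ^ q, x]`. -/
noncomputable def cutFlow (p : A) (hp : p * p = p) (q : ℕ) : HolomorphicAction ℂ A where
  act t x := expConj (t • cutPow p q x) x
  field x := (ContinuousLinearMap.id ℂ ℂ).smulRight (cutPow p q x * x - x * cutPow p q x)
  differentiable := by
    have hexp : Differentiable ℂ (exp : A → A) := fun x =>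
      (exp_analytic (𝕂 := ℂ) x).differentiableAt
    have h1 : Differentiable ℂ fun r : ℂ × A => r.1 • cutPow p q r.2 := by
      unfold cutPow
      fun_prop
    exact ((hexp.comp h1).mul differentiable_snd).mul (hexp.comp h1.neg)
  act_zero x := by rw [zero_smul, expConj_zero]
  act_add s t x := by
    rw [cutPow_expConj_of_le hp hp hp, add_smul, expConj_add]
    exact ((Commute.refl _).smul_left s).smul_right t
  hasFDerivAt_zero x := by
    have h1 := hasDerivAt_exp_smul_const (𝕂 := ℂ) (cutPow p q x) 0
    have h2 := hasDerivAt_exp_smul_const (𝕂 := ℂ) (-cutPow p q x) 0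
    have h3 := (h1.mul_const x).mul h2
    simp only [smul_neg] at h3
    refine h3.hasFDerivAt.congr_fderiv ?_
    ext
    simp [sub_eq_add_neg]

theorem cutFlow_field_one (p : A) (hp : p * p = p) (q : ℕ) (x : A) :
    (cutFlow p hp q).field x 1 = cutPow p q x * x - x * cutPow p q x := by
  simp [cutFlow]

theorem cutFlow_comm {p p' : A} (hp : p * p = p) (hp' : p' * p' = p') (h : p * p' = p)
    (h' : p' * p = p) (q q' : ℕ) (s t : ℂ) (x : A) :
    (cutFlow p hp q).act s ((cutFlow p' hp' q').act t x) =
      (cutFlow p' hp' q').act t ((cutFlow p hp q).act s x) := by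
  change expConj (s • cutPow p q (expConj (t • cutPow p' q' x) x)) (expConj (t • cutPow p' q' x) x)
    = expConj (t • cutPow p' q' (expConj (s • cutPow p q x) x)) (expConj (s • cutPow p q x) x)
  rw [cutPow_expConj_of_le hp' h h', cutPow_expConj_of_ge h h' hp, ← expConj_smul,
    expConj_expConj]

end Flow

end GelfandZeitlin

/-! ### Regular matrices -/

namespace GelfandZeitlin

open Module Polynomial
open scoped DirectSum

section Cyclic

variable {V : Type} [AddCommGroup V] [Module ℂ V]

/-- The evaluation at a vector of the elements of a subspace of endomorphisms. -/
def evalAt (S : Submodule ℂ (End ℂ V)) (v : V) : S →ₗ[ℂ] V :=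
  (LinearMap.applyₗ v) ∘ₗ S.subtype

theorem evalAt_apply (S : Submodule ℂ (End ℂ V)) (v : V) (T : S) :
    evalAt S v T = (T : End ℂ V) v := rfl

variable [FiniteDimensional ℂ V]

/-- By the structure theorem for torsion modules over `ℂ[X]`, the module of an endomorphism is a
sum of cyclic modules. The sum `v` of their generators has the annihilator of the whole module,
and the endomorphisms that are scalar on each summand carry it to any given vector. -/
theorem exists_vector_separating_and_cyclic_for_centralizer (φ : End ℂ V) :
    ∃ v : V, (∀ p : ℂ[X], aeval φ p v = 0 → aeval φ p = 0) ∧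
      ∀ w : V, ∃ T : End ℂ V, Commute T φ ∧ T v = w := by
  obtain ⟨ι, _, q, -, k, ⟨e⟩⟩ := Module.equiv_directSum_of_isTorsion
    (Module.AEval.isTorsion_of_finiteDimensional ℂ V φ)
  let u : ⨁ i : ι, ℂ[X] ⧸ ℂ[X] ∙ q i ^ k i :=
    DFinsupp.equivFunOnFintype.symm fun _ => Submodule.mkQ _ 1
  have hu : ∀ i, u i = Submodule.mkQ _ 1 := fun _ => rfl
  let o := AEval'.of φ
  have hgen : ∀ w : ⨁ i : ι, ℂ[X] ⧸ ℂ[X] ∙ q i ^ k i, ∀ i, ∃ r : ℂ[X], w i = r • u i := by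
    intro w i
    obtain ⟨r, hr⟩ := Submodule.mkQ_surjective _ (w i)
    refine ⟨r, ?_⟩
    rw [hu, ← map_smul, smul_eq_mul, mul_one, hr]
  have hsmul : ∀ (p : ℂ[X]) (w : V), o (aeval φ p w) = p • o w := fun p w =>
    AEval.of_aeval_smul (R := ℂ) φ p w
  refine ⟨o.symm (e.symm u), fun p hp => ?_, fun w => ?_⟩
  · have h1 : p • u = 0 := by
      have := congrArg (fun w => e (o w)) hp
      simpa [hsmul] using this
    ext w
    apply o.injective
    apply e.injective
    rw [hsmul, map_smul]
    simp only [LinearMap.zero_apply, map_zero]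
    refine DFinsupp.ext fun i => ?_
    obtain ⟨r, hr⟩ := hgen (e (o w)) i
    have h2 : p • u i = 0 := DFunLike.congr_fun h1 i
    change p • (e (o w)) i = 0
    rw [hr, smul_comm, h2, smul_zero]
  · choose r hr using hgen (e (o w))
    let D : (⨁ i : ι, ℂ[X] ⧸ ℂ[X] ∙ q i ^ k i) →ₗ[ℂ[X]] ⨁ i : ι, ℂ[X] ⧸ ℂ[X] ∙ q i ^ k i :=
      DFinsupp.mapRange.linearMap fun i => r i • LinearMap.id
    have hD : D u = e (o w) := by
      refine DFinsupp.ext fun i => ?_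
      rw [hr]
      rfl
    let T : AEval' φ →ₗ[ℂ[X]] AEval' φ := e.symm.toLinearMap ∘ₗ D ∘ₗ e.toLinearMap
    refine ⟨o.symm.toLinearMap ∘ₗ T.restrictScalars ℂ ∘ₗ o.toLinearMap, ?_, ?_⟩
    · refine LinearMap.ext fun x => o.injective ?_
      have h1 : ∀ x, o (φ x) = (X : ℂ[X]) • o x := fun x => (AEval'.X_smul_of φ x).symm
      change o (o.symm (T (o (φ x)))) = o (φ (o.symm (T (o x))))
      rw [h1, h1, map_smul]
      simp
    · change o.symm (e.symm (D (e (o (o.symm (e.symm u)))))) = w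
      simp [hD]

/-- The commutant of `φ` does not act faithfully on a proper invariant subspace. -/
theorem exists_commute_ne_zero_of_proper {φ : End ℂ V} {W : Submodule ℂ V} (hW : W ≠ ⊤)
    (hφ : ∀ w ∈ W, φ w ∈ W) : ∃ T : End ℂ V, Commute T φ ∧ T ≠ 0 ∧ ∀ w ∈ W, T w = 0 := by
  -- a linear form `l` that vanishes on `W` and is an eigenvector of the transpose of `φ`
  obtain ⟨l, c, hl0, hlW, hlc⟩ : ∃ (l : Dual ℂ V) (c : ℂ), l ≠ 0 ∧ (∀ w ∈ W, l w = 0) ∧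
      ∀ x, l (φ x) = c * l x := by
    let ψ : End ℂ W.dualAnnihilator := (φ.dualMap).restrict (p := W.dualAnnihilator)
      (q := W.dualAnnihilator) fun l hl => by
        rw [Submodule.mem_dualAnnihilator] at *
        exact fun w hw => hl _ (hφ w hw)
    have hnt : Nontrivial W.dualAnnihilator := by
      rw [Submodule.nontrivial_iff_ne_bot]
      intro h
      exact hW (by rw [← Subspace.dualAnnihilator_dualCoannihilator_eq (W := W), h]; simp)
    obtain ⟨c, hc⟩ := End.exists_eigenvalue ψ
    obtain ⟨l, hl⟩ := hc.exists_hasEigenvector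
    refine ⟨l, c, fun h => hl.2 (Subtype.ext h), (Submodule.mem_dualAnnihilator _).1 l.2,
      fun x => ?_⟩
    have := congrArg (fun l : W.dualAnnihilator => (l : Dual ℂ V) x) hl.apply_eq_smul
    simpa [ψ] using this
  -- the same eigenvalue has an eigenvector `u` of `φ` itself, and `l ⊗ u` commutes with `φ`
  obtain ⟨u, hu0, hu⟩ : ∃ u : V, u ≠ 0 ∧ φ u = c • u := by
    by_contra! hcon
    have hinj : Function.Injective (φ - c • (1 : End ℂ V)) := by
      rw [injective_iff_map_eq_zero]
      intro x hx
      by_contra hx0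
      exact hcon x hx0 (by simpa [sub_eq_zero] using hx)
    have hsurj := LinearMap.injective_iff_surjective.1 hinj
    apply hl0
    ext x
    obtain ⟨y, rfl⟩ := hsurj x
    simp [hlc]
  refine ⟨l.smulRight u, ?_, ?_, fun w hw => by simp [hlW w hw]⟩
  · refine LinearMap.ext fun x => ?_
    change l (φ x) • u = φ (l x • u)
    rw [hlc, map_smul, hu, smul_smul, mul_comm]
  · intro h
    apply hl0
    ext x
    have := DFunLike.congr_fun h x
    simpa [hu0] using this

/-- Both the commutant of `φ` and `ℂ[φ]` have dimension `dim V` exactly when `φ` has a cyclic vector.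
With `v` as above, evaluation at `v` is onto `V` on the commutant, and injective on `ℂ[φ]`. -/
theorem finrank_centralizer_and_adjoin (φ : End ℂ V) :
    finrank ℂ V ≤ finrank ℂ (Subalgebra.centralizer ℂ ({φ} : Set (End ℂ V))) ∧
    (finrank ℂ (Subalgebra.centralizer ℂ ({φ} : Set (End ℂ V))) = finrank ℂ V ↔
      finrank ℂ (Algebra.adjoin ℂ ({φ} : Set (End ℂ V))) = finrank ℂ V) := by
  obtain ⟨v, hv1, hv2⟩ := exists_vector_separating_and_cyclic_for_centralizer φ
  let C := Subalgebra.toSubmodule (Subalgebra.centralizer ℂ ({φ} : Set (End ℂ V)))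
  let B := Subalgebra.toSubmodule (Algebra.adjoin ℂ ({φ} : Set (End ℂ V)))
  have hC : ∀ T, T ∈ C ↔ Commute T φ := fun T => by
    simp only [C, Subalgebra.mem_toSubmodule, Subalgebra.mem_centralizer_iff,
      Set.mem_singleton_iff, forall_eq]
    exact eq_comm
  have hB : ∀ T, T ∈ B ↔ ∃ p : ℂ[X], aeval φ p = T := fun T => by
    simp only [B, Subalgebra.mem_toSubmodule, Algebra.adjoin_singleton_eq_range_aeval]
    rfl
  have hCsurj : Function.Surjective (evalAt C v) := fun w => by
    obtain ⟨T, hT, h⟩ := hv2 w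
    exact ⟨⟨T, (hC T).2 hT⟩, h⟩
  have hBinj : Function.Injective (evalAt B v) := by
    rw [injective_iff_map_eq_zero]
    rintro ⟨T, hT⟩ h
    obtain ⟨p, rfl⟩ := (hB T).1 hT
    exact Subtype.ext (hv1 p h)
  have hle : finrank ℂ V ≤ finrank ℂ C := LinearMap.finrank_le_finrank_of_surjective hCsurj
  refine ⟨hle, fun h => ?_, fun h => ?_⟩
  · have hCinj : Function.Injective (evalAt C v) :=
      (LinearMap.injective_iff_surjective_of_finrank_eq_finrank h).2 hCsurj
    have hBsurj : LinearMap.range (evalAt B v) = ⊤ := by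
      by_contra hne
      obtain ⟨T, hT, hT0, hTv⟩ := exists_commute_ne_zero_of_proper hne (φ := φ) (by
        rintro _ ⟨⟨T, hT⟩, rfl⟩
        obtain ⟨p, rfl⟩ := (hB T).1 hT
        exact ⟨⟨aeval φ (X * p), (hB _).2 ⟨_, rfl⟩⟩, by simp [evalAt_apply]⟩)
      have h1 : evalAt C v ⟨T, (hC T).2 hT⟩ = 0 :=
        hTv v ⟨⟨1, (hB 1).2 ⟨1, by simp⟩⟩, rfl⟩
      exact hT0 (congrArg Subtype.val (hCinj (h1.trans (map_zero _).symm)))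
    exact (LinearEquiv.ofBijective (evalAt B v) ⟨hBinj, LinearMap.range_eq_top.1 hBsurj⟩).finrank_eq
  · have hBsurj : Function.Surjective (evalAt B v) :=
      (LinearMap.injective_iff_surjective_of_finrank_eq_finrank h).1 hBinj
    refine le_antisymm ?_ hle
    refine LinearMap.finrank_le_finrank_of_injective (f := evalAt C v) ?_
    rw [injective_iff_map_eq_zero]
    rintro ⟨T, hT⟩ h0
    refine Subtype.ext (LinearMap.ext fun w => ?_)
    obtain ⟨⟨S, hS⟩, rfl⟩ := hBsurj w
    obtain ⟨p, rfl⟩ := (hB S).1 hS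
    have hcomm : Commute T (aeval φ p) := by
      have : T ∈ Subalgebra.centralizer ℂ ({φ} : Set (End ℂ V)) := hT
      have h2 := Algebra.adjoin_le_centralizer_centralizer ℂ ({φ} : Set (End ℂ V)) hS
      exact (Subalgebra.mem_centralizer_iff ℂ).1 h2 T this
    change T (aeval φ p v) = 0
    have h3 : T v = 0 := h0
    rw [← Module.End.mul_apply, hcomm.eq, Module.End.mul_apply, h3, map_zero]

end Cyclic

/-- The powers `1, y, …, y ^ (m - 1)` span the algebra generated by an `m × m` matrix. -/
theorem adjoin_eq_span_pow {m : ℕ} (y : M m) :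
    Subalgebra.toSubmodule (Algebra.adjoin ℂ {y}) =
      Submodule.span ℂ {z | ∃ q < m, z = y ^ q} := by
  apply le_antisymm
  · intro z hz
    rw [Subalgebra.mem_toSubmodule, Algebra.adjoin_singleton_eq_range_aeval] at hz
    obtain ⟨p, rfl⟩ := hz
    change aeval y p ∈ _
    rcases Nat.eq_zero_or_pos m with rfl | hm
    · rw [Subsingleton.elim (aeval y p) 0]
      exact zero_mem _
    · have : Nonempty (Fin m) := ⟨⟨0, hm⟩⟩
      rw [Matrix.aeval_eq_aeval_mod_charpoly, aeval_eq_sum_range' (n := m)]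
      · refine Submodule.sum_mem _ fun q hq => Submodule.smul_mem _ _ ?_
        exact Submodule.subset_span ⟨q, Finset.mem_range.1 hq, rfl⟩
      · have h1 := natDegree_modByMonic_lt p y.charpoly_monic (fun h => by
          have := y.charpoly_natDegree_eq_dim
          rw [h, natDegree_one, Fintype.card_fin] at this
          omega)
        rwa [y.charpoly_natDegree_eq_dim, Fintype.card_fin] at h1
  · rw [Submodule.span_le]
    rintro _ ⟨q, -, rfl⟩
    exact pow_mem (Algebra.self_mem_adjoin_singleton ℂ y) q

theorem finrank_centralizer_and_adjoin_matrix {m : ℕ} (y : M m) :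
    m ≤ finrank ℂ (Subalgebra.centralizer ℂ ({y} : Set (M m))) ∧
    (IsRegularMatrix y ↔ finrank ℂ (Algebra.adjoin ℂ ({y} : Set (M m))) = m) := by
  have h := finrank_centralizer_and_adjoin (Matrix.toLinAlgEquiv' y)
  let E : M m ≃ₐ[ℂ] End ℂ (Fin m → ℂ) := Matrix.toLinAlgEquiv'
  have h1 : finrank ℂ (Algebra.adjoin ℂ ({E y} : Set (End ℂ (Fin m → ℂ)))) =
      finrank ℂ (Algebra.adjoin ℂ ({y} : Set (M m))) := by
    have : Algebra.adjoin ℂ ({E y} : Set (End ℂ (Fin m → ℂ))) =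
        (Algebra.adjoin ℂ ({y} : Set (M m))).map E.toAlgHom := by
      rw [AlgHom.map_adjoin]
      simp
    rw [this]
    exact LinearEquiv.finrank_map_eq E.toLinearEquiv
      (Subalgebra.toSubmodule (Algebra.adjoin ℂ ({y} : Set (M m))))
  have h2 : finrank ℂ (Subalgebra.centralizer ℂ ({E y} : Set (End ℂ (Fin m → ℂ)))) =
      finrank ℂ (Subalgebra.centralizer ℂ ({y} : Set (M m))) := by
    have : Subalgebra.toSubmodule (Subalgebra.centralizer ℂ ({E y} : Set (End ℂ (Fin m → ℂ)))) =
        (Subalgebra.toSubmodule (Subalgebra.centralizer ℂ ({y} : Set (M m)))).map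
          (E.toLinearEquiv : M m →ₗ[ℂ] _) := by
      ext T
      simp only [Subalgebra.mem_toSubmodule, Subalgebra.mem_centralizer_iff,
        Set.mem_singleton_iff, forall_eq, Submodule.mem_map]
      constructor
      · intro hT
        refine ⟨E.symm T, E.injective ?_, by simp⟩
        simpa using hT
      · rintro ⟨S, hS, rfl⟩
        simpa using congrArg E hS
    have h3 := LinearEquiv.finrank_map_eq E.toLinearEquiv
      (Subalgebra.toSubmodule (Subalgebra.centralizer ℂ ({y} : Set (M m))))
    rw [← this] at h3
    exact h3
  change finrank ℂ (Fin m → ℂ) ≤ finrank ℂ (Subalgebra.centralizer ℂ {E y}) ∧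
    (finrank ℂ (Subalgebra.centralizer ℂ {E y}) = finrank ℂ (Fin m → ℂ) ↔
      finrank ℂ (Algebra.adjoin ℂ {E y}) = finrank ℂ (Fin m → ℂ)) at h
  rw [h1, h2, finrank_fin_fun] at h
  exact h

theorem le_finrank_centralizer {m : ℕ} (y : M m) :
    m ≤ finrank ℂ (Subalgebra.centralizer ℂ ({y} : Set (M m))) :=
  (finrank_centralizer_and_adjoin_matrix y).1

theorem isRegularMatrix_iff {m : ℕ} (y : M m) :
    IsRegularMatrix y ↔ finrank ℂ (Algebra.adjoin ℂ ({y} : Set (M m))) = m :=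
  (finrank_centralizer_and_adjoin_matrix y).2

theorem adjoin_le_centralizer {m : ℕ} (y : M m) :
    Algebra.adjoin ℂ {y} ≤ Subalgebra.centralizer ℂ {y} := by
  refine Algebra.adjoin_le ?_
  rw [Set.singleton_subset_iff, SetLike.mem_coe, Subalgebra.mem_centralizer_iff]
  simp

/-- What commutes with a regular matrix is a polynomial in it. -/
theorem IsRegularMatrix.mem_adjoin {m : ℕ} {y z : M m} (hy : IsRegularMatrix y)
    (hz : Commute z y) : z ∈ Algebra.adjoin ℂ {y} := by
  have h : Subalgebra.toSubmodule (Algebra.adjoin ℂ {y}) =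
      Subalgebra.toSubmodule (Subalgebra.centralizer ℂ {y}) :=
    Submodule.eq_of_le_of_finrank_eq (adjoin_le_centralizer y)
      (((isRegularMatrix_iff y).1 hy).trans hy.symm)
  rw [← Subalgebra.mem_toSubmodule, h, Subalgebra.mem_toSubmodule,
    Subalgebra.mem_centralizer_iff]
  simpa using hz.eq.symm

end GelfandZeitlin

namespace GelfandZeitlin

open Module

/-! ### Corners -/

/-- The `n × m` matrix of the inclusion `ℂᵐ ⊆ ℂⁿ`. -/
def incl {m n : ℕ} (h : m ≤ n) : Matrix (Fin n) (Fin m) ℂ :=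
  (1 : Matrix (Fin n) (Fin n) ℂ).submatrix id (Fin.castLE h)

theorem cutoff_eq {m n : ℕ} (h : m ≤ n) (x : M n) :
    cutoff h x = (incl h).transpose * x * incl h := by
  ext a b
  simp [cutoff, incl, Matrix.mul_apply, Matrix.one_apply]

theorem corner_eq {m n : ℕ} (h : m ≤ n) (y : M m) :
    corner n y = incl h * y * (incl h).transpose := by
  ext i j
  simp only [corner, Matrix.of_apply, incl, Matrix.mul_apply, Matrix.submatrix_apply,
    Matrix.transpose_apply, Matrix.one_apply, id, ite_mul, one_mul, zero_mul, mul_ite, mul_one,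
    mul_zero]
  by_cases hi : (i : ℕ) < m
  · have hi' : ∀ a : Fin m, i = Fin.castLE h a ↔ (⟨i, hi⟩ : Fin m) = a := fun a => by
      simp [Fin.ext_iff]
    by_cases hj : (j : ℕ) < m
    · have hj' : ∀ a : Fin m, j = Fin.castLE h a ↔ (⟨j, hj⟩ : Fin m) = a := fun a => by
        simp [Fin.ext_iff]
      simp [hi', hj', hi, hj]
    · have hj' : ∀ a : Fin m, j ≠ Fin.castLE h a := fun a ha => hj (by simp [ha])
      simp [hj', hj]
  · have hi' : ∀ a : Fin m, i ≠ Fin.castLE h a := fun a ha => hi (by simp [ha])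
    simp [hi', hi]

theorem transpose_incl_mul_incl {m n : ℕ} (h : m ≤ n) :
    (incl h).transpose * incl h = 1 := by
  rw [← Matrix.mul_one (incl h).transpose, ← cutoff_eq]
  ext a b
  simp [cutoff, Matrix.one_apply]

theorem cutoff_corner {m n : ℕ} (h : m ≤ n) (y : M m) : cutoff h (corner n y) = y := by
  have h1 := transpose_incl_mul_incl h
  rw [cutoff_eq, corner_eq h]
  calc (incl h).transpose * (incl h * y * (incl h).transpose) * incl h
      = ((incl h).transpose * incl h) * y * ((incl h).transpose * incl h) := by
        simp only [Matrix.mul_assoc]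
    _ = y := by rw [h1, Matrix.one_mul, Matrix.mul_one]

/-- The inclusion of `M m` into `M n` as the upper left corner, as a homomorphism. -/
def cornerHom {m n : ℕ} (h : m ≤ n) : M m →ₙₐ[ℂ] M n where
  toFun := corner n
  map_smul' c y := by simp [corner_eq h]
  map_zero' := by simp [corner_eq h]
  map_add' y z := by simp [corner_eq h, Matrix.mul_add, Matrix.add_mul]
  map_mul' y z := by
    have h1 := transpose_incl_mul_incl h
    rw [corner_eq h, corner_eq h, corner_eq h]
    calc incl h * (y * z) * (incl h).transpose
        = incl h * y * (1 : M m) * z * (incl h).transpose := by simp only [Matrix.mul_assoc, Matrix.one_mul]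
      _ = _ := by rw [← h1]; simp only [Matrix.mul_assoc]

theorem cornerHom_apply {m n : ℕ} (h : m ≤ n) (y : M m) : cornerHom h y = corner n y := rfl

theorem cornerHom_injective {m n : ℕ} (h : m ≤ n) : Function.Injective (cornerHom h) :=
  Function.LeftInverse.injective (cutoff_corner h)

/-- The identity matrix of the corner `M m`, an idempotent of `M n`. -/
def proj (n m : ℕ) : M n := corner n (1 : M m)

theorem proj_eq_diagonal (n m : ℕ) :
    proj n m = Matrix.diagonal fun i : Fin n => if (i : ℕ) < m then 1 else 0 := by
  ext i j
  simp only [proj, corner, Matrix.of_apply, Matrix.one_apply, Matrix.diagonal_apply, Fin.ext_iff]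
  split_ifs <;> first | rfl | omega

theorem proj_mul_proj_of_le {n m k : ℕ} (h : m ≤ k) : proj n m * proj n k = proj n m := by
  rw [proj_eq_diagonal, proj_eq_diagonal, Matrix.diagonal_mul_diagonal]
  congr 1
  funext i
  split_ifs <;> first | (exfalso; omega) | simp

theorem proj_mul_proj_of_ge {n m k : ℕ} (h : m ≤ k) : proj n k * proj n m = proj n m := by
  rw [proj_eq_diagonal, proj_eq_diagonal, Matrix.diagonal_mul_diagonal]
  congr 1
  funext i
  split_ifs <;> first | (exfalso; omega) | simp

theorem proj_mul_self (n m : ℕ) : proj n m * proj n m = proj n m := proj_mul_proj_of_le le_rfl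

theorem proj_self (n : ℕ) : proj n n = 1 := by
  rw [proj_eq_diagonal]
  simp

theorem proj_mul_mul_proj {m n : ℕ} (h : m ≤ n) (x : M n) :
    proj n m * x * proj n m = corner n (cutoff h x) := by
  rw [proj, corner_eq h, corner_eq h, cutoff_eq]
  simp only [Matrix.mul_assoc, Matrix.one_mul]

theorem cutPow_proj {m n : ℕ} (h : m ≤ n) (q : ℕ) (x : M n) :
    cutPow (proj n m) q x = corner n (cutoff h x ^ q) := by
  rw [cutPow, proj_mul_mul_proj h]
  induction q with
  | zero => rw [pow_zero, pow_zero, mul_one, proj]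
  | succ q ih =>
    rw [pow_succ, pow_succ, ← mul_assoc, ih, ← cornerHom_apply h, ← cornerHom_apply h,
      ← cornerHom_apply h, map_mul]

theorem proj_mul_cutPow {n m k : ℕ} (h : m ≤ k) (q : ℕ) (x : M n) :
    proj n k * cutPow (proj n m) q x = cutPow (proj n m) q x := by
  rw [cutPow, ← mul_assoc, proj_mul_proj_of_ge h]

theorem cutPow_mul_proj {n m k : ℕ} (h : m ≤ k) (q : ℕ) (x : M n) :
    cutPow (proj n m) q x * proj n k = cutPow (proj n m) q x := by
  have h1 : cutPow (proj n m) q x = cutPow (proj n m) q x * proj n m := by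
    rw [← (commute_cutPow (proj_mul_self n m) q x).eq, proj_mul_cutPow le_rfl]
  rw [h1, mul_assoc, proj_mul_proj_of_le h]

theorem trace_corner_mul {m n : ℕ} (h : m ≤ n) (y : M m) (v : M n) :
    (corner n y * v).trace = (y * cutoff h v).trace := by
  rw [corner_eq h, cutoff_eq, Matrix.mul_assoc, Matrix.mul_assoc, Matrix.trace_mul_comm]
  simp only [Matrix.mul_assoc]

/-! ### The spans of the powers of the cutoffs -/

/-- The span of the powers of the cutoff `x_m`: it is the algebra `Z_{x,m}` as a subspace. -/
def zSpan {n : ℕ} (m : ℕ) (x : M n) : Submodule ℂ (M n) :=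
  Submodule.span ℂ {z | ∃ q < m, z = cutPow (proj n m) q x}

/-- The sum of the algebras `Z_{x,m}`, `m ≤ k`, as a subspace. -/
def sSpan {n : ℕ} (k : ℕ) (x : M n) : Submodule ℂ (M n) :=
  Submodule.span ℂ {z | ∃ m ≤ k, ∃ q < m, z = cutPow (proj n m) q x}

theorem sSpan_zero {n : ℕ} (x : M n) : sSpan 0 x = ⊥ := by
  rw [sSpan, Submodule.span_eq_bot]
  rintro z ⟨m, hm, q, hq, -⟩
  omega

theorem sSpan_succ {n : ℕ} (k : ℕ) (x : M n) : sSpan (k + 1) x = sSpan k x ⊔ zSpan (k + 1) x := by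
  rw [sSpan, sSpan, zSpan, ← Submodule.span_union]
  congr 1
  ext z
  constructor
  · rintro ⟨m, hm, q, hq, rfl⟩
    rcases Nat.lt_or_ge k m with h | h
    · obtain rfl : m = k + 1 := by omega
      exact Or.inr ⟨q, hq, rfl⟩
    · exact Or.inl ⟨m, h, q, hq, rfl⟩
  · rintro (⟨m, hm, q, hq, rfl⟩ | ⟨q, hq, rfl⟩)
    · exact ⟨m, by omega, q, hq, rfl⟩
    · exact ⟨k + 1, le_rfl, q, hq, rfl⟩

theorem zSpan_le_sSpan {n : ℕ} (m : ℕ) (x : M n) : zSpan m x ≤ sSpan m x := by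
  refine Submodule.span_mono ?_
  rintro z ⟨q, hq, rfl⟩
  exact ⟨m, le_rfl, q, hq, rfl⟩

theorem zSpan_eq_map {m n : ℕ} (h : m ≤ n) (x : M n) :
    zSpan m x = (Subalgebra.toSubmodule (Algebra.adjoin ℂ {cutoff h x})).map
      (cornerHom h : M m →ₗ[ℂ] M n) := by
  rw [adjoin_eq_span_pow, Submodule.map_span, zSpan]
  congr 1
  ext z
  constructor
  · rintro ⟨q, hq, rfl⟩
    exact ⟨_, ⟨q, hq, rfl⟩, (cutPow_proj h q x).symm⟩
  · rintro ⟨_, ⟨q, hq, rfl⟩, rfl⟩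
    exact ⟨q, hq, (cutPow_proj h q x).symm⟩

theorem finrank_zSpan {m n : ℕ} (h : m ≤ n) (x : M n) :
    finrank ℂ (zSpan m x) = finrank ℂ (Algebra.adjoin ℂ {cutoff h x}) := by
  rw [zSpan_eq_map h]
  exact (Submodule.equivMapOfInjective (cornerHom h : M m →ₗ[ℂ] M n) (cornerHom_injective h)
    (Subalgebra.toSubmodule (Algebra.adjoin ℂ {cutoff h x}))).finrank_eq.symm

theorem isRegularMatrix_cutoff_iff {m n : ℕ} (h : m ≤ n) (x : M n) :
    IsRegularMatrix (cutoff h x) ↔ finrank ℂ (zSpan m x) = m := by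
  rw [finrank_zSpan h, isRegularMatrix_iff]

theorem toSubmodule_Z {m n : ℕ} (h : m ≤ n) (x : M n) : (Z h x).toSubmodule = zSpan m x := by
  apply le_antisymm
  · have : Z h x ≤ (Algebra.adjoin ℂ {cutoff h x}).toNonUnitalSubalgebra.map (cornerHom h) := by
      refine NonUnitalAlgebra.adjoin_le ?_
      rintro _ (rfl | rfl)
      · exact ⟨1, one_mem (Algebra.adjoin ℂ {cutoff h x}), rfl⟩
      · exact ⟨_, Algebra.self_mem_adjoin_singleton ℂ _, rfl⟩
    intro z hz
    obtain ⟨y, hy, rfl⟩ := this hz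
    rw [zSpan_eq_map h]
    exact ⟨y, hy, rfl⟩
  · rw [zSpan, Submodule.span_le]
    rintro _ ⟨q, -, rfl⟩
    rw [cutPow_proj h]
    change corner n (cutoff h x ^ q) ∈ Z h x
    induction q with
    | zero => exact NonUnitalAlgebra.subset_adjoin ℂ (Or.inl rfl)
    | succ q ih =>
      rw [pow_succ, ← cornerHom_apply h, map_mul]
      exact mul_mem ih (NonUnitalAlgebra.subset_adjoin ℂ (Or.inr rfl))

theorem finrank_Z {m n : ℕ} (h : m ≤ n) (x : M n) :
    finrank ℂ (Z h x) = finrank ℂ (zSpan m x) := by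
  rw [← toSubmodule_Z h]
  rfl

theorem Z_inf_Z_eq_bot_iff {m n : ℕ} (h : m + 1 ≤ n) (x : M n) :
    Z (Nat.le_of_succ_le h) x ⊓ Z h x = ⊥ ↔ zSpan m x ⊓ zSpan (m + 1) x = ⊥ := by
  rw [← toSubmodule_Z h, ← toSubmodule_Z (Nat.le_of_succ_le h), eq_bot_iff, eq_bot_iff]
  exact ⟨fun hb w hw => NonUnitalAlgebra.mem_bot.1 (hb hw),
    fun hb w hw => NonUnitalAlgebra.mem_bot.2 (hb hw)⟩

theorem zSpan_eq_span_range {n : ℕ} (m : ℕ) (x : M n) :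
    zSpan m x = Submodule.span ℂ (Set.range fun q : Fin m => cutPow (proj n m) q x) := by
  rw [zSpan]
  congr 1
  ext z
  constructor
  · rintro ⟨q, hq, rfl⟩
    exact ⟨⟨q, hq⟩, rfl⟩
  · rintro ⟨q, rfl⟩
    exact ⟨q, q.2, rfl⟩

theorem finrank_zSpan_le {n : ℕ} (m : ℕ) (x : M n) : finrank ℂ (zSpan m x) ≤ m := by
  rw [zSpan_eq_span_range]
  exact (finrank_range_le_card _).trans_eq (Fintype.card_fin m)

theorem d_zero : d 0 = 0 := rfl

theorem d_succ (k : ℕ) : d (k + 1) = d k + (k + 1) := by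
  rw [d, d, show (k + 1) * (k + 1 + 1) = k * (k + 1) + (k + 1) * 2 by ring,
    Nat.add_mul_div_right _ _ two_pos]

theorem two_mul_d (k : ℕ) : 2 * d k = k * (k + 1) := by
  induction k with
  | zero => rfl
  | succ k ih => rw [d_succ, mul_add, ih]; ring

theorem finrank_sSpan_succ {n : ℕ} (k : ℕ) (x : M n) :
    finrank ℂ (sSpan (k + 1) x) + finrank ℂ (sSpan k x ⊓ zSpan (k + 1) x : Submodule ℂ (M n)) =
      finrank ℂ (sSpan k x) + finrank ℂ (zSpan (k + 1) x) := by
  rw [sSpan_succ, Submodule.finrank_sup_add_finrank_inf_eq]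

theorem finrank_sSpan_le {n : ℕ} (k : ℕ) (x : M n) : finrank ℂ (sSpan k x) ≤ d k := by
  induction k with
  | zero =>
    rw [sSpan_zero, finrank_bot]
    exact Nat.zero_le _
  | succ k ih =>
    have h1 := finrank_sSpan_succ k x
    have h2 := finrank_zSpan_le (k + 1) x
    rw [d_succ]
    omega

theorem finrank_sSpan_succ_eq_iff {n : ℕ} (k : ℕ) (x : M n) :
    finrank ℂ (sSpan (k + 1) x) = d (k + 1) ↔ finrank ℂ (sSpan k x) = d k ∧
      finrank ℂ (zSpan (k + 1) x) = k + 1 ∧ sSpan k x ⊓ zSpan (k + 1) x = ⊥ := by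
  have h1 := finrank_sSpan_succ k x
  have h2 := finrank_zSpan_le (k + 1) x
  have h3 := finrank_sSpan_le k x
  rw [d_succ, ← Submodule.finrank_eq_zero (R := ℂ)]
  omega

theorem sSpan_supported {n k : ℕ} {x w : M n} (hw : w ∈ sSpan k x) :
    proj n k * w = w ∧ w * proj n k = w := by
  induction hw using Submodule.span_induction with
  | mem z hz =>
    obtain ⟨m, hm, q, -, rfl⟩ := hz
    exact ⟨proj_mul_cutPow hm q x, cutPow_mul_proj hm q x⟩
  | zero => simp
  | add y z _ _ hy hz => rw [mul_add, add_mul, hy.1, hy.2, hz.1, hz.2]; simp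
  | smul c z _ hz => rw [mul_smul_comm, smul_mul_assoc, hz.1, hz.2]; simp

theorem commute_of_mem_zSpan {n m : ℕ} {x w : M n} (hw : w ∈ zSpan m x) :
    Commute w (proj n m * x * proj n m) := by
  induction hw using Submodule.span_induction with
  | mem z hz =>
    obtain ⟨q, -, rfl⟩ := hz
    exact (cut_commute_cutPow (proj_mul_self n m) q x).symm
  | zero => exact Commute.zero_left _
  | add y z _ _ hy hz => exact hy.add_left hz
  | smul c z _ hz => exact hz.smul_left c

/-- If `x_m` is regular, then a matrix in the corner `M m` that commutes with `x_m` is in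
`Z_{x,m}`. -/
theorem mem_zSpan_of_commute {n m : ℕ} (h : m ≤ n) {x w : M n}
    (hreg : finrank ℂ (zSpan m x) = m) (h1 : proj n m * w = w) (h2 : w * proj n m = w)
    (hc : Commute w (proj n m * x * proj n m)) : w ∈ zSpan m x := by
  have hw : cornerHom h (cutoff h w) = w := by
    rw [cornerHom_apply, ← proj_mul_mul_proj, h1, h2]
  rw [zSpan_eq_map h]
  refine ⟨cutoff h w, ?_, hw⟩
  refine ((isRegularMatrix_cutoff_iff h x).2 hreg).mem_adjoin (cornerHom_injective h ?_)
  rw [map_mul, map_mul, hw, cornerHom_apply, ← proj_mul_mul_proj]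
  exact hc

/-- For regular cutoffs, it is enough that consecutive algebras `Z_{x,m}` intersect trivially:
a matrix in `Z_{x,k+1}` that lies in the corner `M k` commutes with `x_k`, so it is in `Z_{x,k}`
by regularity. -/
theorem finrank_sSpan_eq_iff {n : ℕ} (x : M n) :
    finrank ℂ (sSpan n x) = d n ↔
      (∀ m ≤ n, 1 ≤ m → finrank ℂ (zSpan m x) = m) ∧
        ∀ m, m + 1 ≤ n → 1 ≤ m → zSpan m x ⊓ zSpan (m + 1) x = ⊥ := by
  constructor
  · intro h
    have hdown : ∀ j k, k + j = n → finrank ℂ (sSpan k x) = d k := by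
      intro j
      induction j with
      | zero => rintro k rfl; exact h
      | succ j ih =>
        intro k hk
        exact ((finrank_sSpan_succ_eq_iff k x).1 (ih (k + 1) (by omega))).1
    have hall : ∀ k, k + 1 ≤ n → _ := fun k hk =>
      (finrank_sSpan_succ_eq_iff k x).1 (hdown (n - (k + 1)) (k + 1) (by omega))
    refine ⟨fun m hm h1 => ?_, fun m hm _ => ?_⟩
    · obtain ⟨k, rfl⟩ : ∃ k, m = k + 1 := ⟨m - 1, by omega⟩
      exact (hall k hm).2.1
    · exact eq_bot_mono (inf_le_inf_right _ (zSpan_le_sSpan m x)) (hall m hm).2.2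
  · rintro ⟨h1, h2⟩
    have hup : ∀ k ≤ n, finrank ℂ (sSpan k x) = d k := by
      intro k
      induction k with
      | zero => simp [sSpan_zero, d_zero]
      | succ k ih =>
        intro hk
        refine (finrank_sSpan_succ_eq_iff k x).2
          ⟨ih (by omega), h1 _ hk (by omega), ?_⟩
        rcases Nat.eq_zero_or_pos k with rfl | hk0
        · simp [sSpan_zero]
        rw [eq_bot_iff, ← h2 k hk hk0]
        rintro w ⟨hw1, hw2⟩
        refine ⟨?_, hw2⟩
        obtain ⟨e1, e2⟩ := sSpan_supported hw1
        refine mem_zSpan_of_commute (by omega) (h1 k (by omega) hk0) e1 e2 ?_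
        have hc := (commute_of_mem_zSpan hw2).eq
        have e3 : proj n k * proj n (k + 1) = proj n k := proj_mul_proj_of_le (by omega)
        have e4 : proj n (k + 1) * proj n k = proj n k := proj_mul_proj_of_ge (by omega)
        have h3 : w * (proj n k * x * proj n k) =
            proj n k * (w * (proj n (k + 1) * x * proj n (k + 1))) * proj n k := by
          have : w * proj n (k + 1) = w := by rw [← e2, mul_assoc, e3]
          simp only [mul_assoc, e4]
          simp only [← mul_assoc]
          rw [e1, this, e2]
        have h4 : (proj n k * x * proj n k) * w =
            proj n k * ((proj n (k + 1) * x * proj n (k + 1)) * w) * proj n k := by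
          have : proj n (k + 1) * w = w := by rw [← e1, ← mul_assoc, e4]
          simp only [← mul_assoc, e3]
          simp only [mul_assoc]
          rw [e2, this, e1]
        rw [Commute, SemiconjBy, h3, hc, ← h4]
    exact hup n le_rfl

end GelfandZeitlin

namespace GelfandZeitlin

open Module

/-! ### Brackets with `x` -/

/-- The map `w ↦ [w, x]`. -/
def bracket {n : ℕ} (x : M n) : M n →ₗ[ℂ] M n :=
  LinearMap.mulRight ℂ x - LinearMap.mulLeft ℂ x

theorem bracket_apply {n : ℕ} (x w : M n) : bracket x w = w * x - x * w := rfl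

theorem mem_ker_bracket {n : ℕ} {x w : M n} : w ∈ LinearMap.ker (bracket x) ↔ Commute w x := by
  rw [LinearMap.mem_ker, bracket_apply, sub_eq_zero]
  rfl

theorem ker_bracket {n : ℕ} (x : M n) :
    LinearMap.ker (bracket x) = Subalgebra.toSubmodule (Subalgebra.centralizer ℂ {x}) := by
  ext w
  rw [mem_ker_bracket, Subalgebra.mem_toSubmodule, Subalgebra.mem_centralizer_iff]
  simp only [Set.mem_singleton_iff, forall_eq]
  exact eq_comm

/-- The trace form, as a map from `M n` to its dual space. -/
def traceDual (n : ℕ) : M n →ₗ[ℂ] Dual ℂ (M n) :=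
  (LinearMap.mul ℂ (M n)).compr₂ (Matrix.traceLinearMap (Fin n) ℂ ℂ)

theorem traceDual_apply {n : ℕ} (u w : M n) : traceDual n u w = (u * w).trace := rfl

theorem traceDual_injective (n : ℕ) : Function.Injective (traceDual n) := fun _ _ h =>
  Matrix.ext_iff_trace_mul_right.2 fun w => DFunLike.congr_fun h w

theorem finrank_add_finrank_le_of_trace_eq_zero {n : ℕ} {S U : Submodule ℂ (M n)}
    (h : ∀ u ∈ S, ∀ w ∈ U, (u * w).trace = 0) : finrank ℂ S + finrank ℂ U ≤ n * n := by
  have h1 : S.map (traceDual n) ≤ U.dualAnnihilator := by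
    rintro _ ⟨u, hu, rfl⟩
    rw [Submodule.mem_dualAnnihilator]
    exact fun w hw => h u hu w hw
  have h2 := Submodule.finrank_mono h1
  rw [← (Submodule.equivMapOfInjective _ (traceDual_injective n) S).finrank_eq] at h2
  have h3 := Subspace.finrank_add_finrank_dualAnnihilator_eq U
  rw [finrank_matrix, Fintype.card_fin, finrank_self] at h3
  omega

/-- Since `z_{m,q}` is in the corner `M k`, only the corner of `[z_{k,r}, x]` matters. It is zero
because `z_{k,r}` commutes with `x_k`. -/
theorem trace_mul_bracket_of_le {n m k : ℕ} (h : m ≤ k) (q r : ℕ) (x : M n) :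
    (cutPow (proj n m) q x * bracket x (cutPow (proj n k) r x)).trace = 0 := by
  set u := cutPow (proj n m) q x with hu
  set v := cutPow (proj n k) r x with hv
  have e1 : proj n k * u = u := proj_mul_cutPow h q x
  have e2 : u * proj n k = u := cutPow_mul_proj h q x
  have e3 : proj n k * v = v := proj_mul_cutPow le_rfl r x
  have e4 : v * proj n k = v := cutPow_mul_proj le_rfl r x
  have hc : v * (proj n k * x * proj n k) = (proj n k * x * proj n k) * v :=
    (cut_commute_cutPow (proj_mul_self n k) r x).symm
  have h1 : proj n k * (v * x) * proj n k = v * (proj n k * x * proj n k) := by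
    simp only [← mul_assoc]
    rw [e3, e4]
  have h2 : proj n k * (x * v) * proj n k = (proj n k * x * proj n k) * v := by
    rw [mul_assoc, mul_assoc, e4, mul_assoc, e3, mul_assoc]
  have h3 : ∀ w, (u * w).trace = (u * (proj n k * w * proj n k)).trace := fun w => by
    rw [← mul_assoc, ← mul_assoc, e2, Matrix.trace_mul_comm (u * w), ← mul_assoc, e1]
  rw [bracket_apply, h3, mul_sub, sub_mul, h1, h2, hc, sub_self, mul_zero, Matrix.trace_zero]

theorem trace_mul_bracket_comm {n : ℕ} (x u v : M n) :
    (u * bracket x v).trace = -(v * bracket x u).trace := by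
  rw [bracket_apply, bracket_apply, mul_sub, mul_sub, Matrix.trace_sub, Matrix.trace_sub,
    ← mul_assoc, ← mul_assoc, ← mul_assoc, ← mul_assoc, Matrix.trace_mul_comm (u * v),
    Matrix.trace_mul_comm (u * x), ← mul_assoc, ← mul_assoc, Matrix.trace_mul_comm (v * u) x,
    ← mul_assoc]
  have h1 : (x * u * v).trace = (v * x * u).trace := by
    rw [Matrix.trace_mul_comm, mul_assoc]
  rw [h1]
  ring

/-- The functions `f_{(k,m)}` Poisson commute: up to sign, `tr (u [v, x])` is the bracket at `x` of
two functions with gradients `u` and `v`. -/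
theorem trace_mul_bracket_eq_zero {n k l : ℕ} {x u v : M n} (hu : u ∈ sSpan k x)
    (hv : v ∈ sSpan l x) : (u * bracket x v).trace = 0 := by
  let B : M n →ₗ[ℂ] M n →ₗ[ℂ] ℂ := (traceDual n).compl₂ (bracket x)
  have hB : ∀ u v, B u v = (u * bracket x v).trace := fun _ _ => rfl
  have : sSpan k x ≤ LinearMap.ker ((B.flip) v) := by
    refine Submodule.span_le.2 ?_
    rintro _ ⟨m, -, q, -, rfl⟩
    rw [SetLike.mem_coe, LinearMap.mem_ker, LinearMap.flip_apply, ← LinearMap.mem_ker]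
    revert hv
    refine fun hv => (Submodule.span_le (p := LinearMap.ker (B (cutPow (proj n m) q x)))).2 ?_ hv
    rintro _ ⟨m', -, q', -, rfl⟩
    rw [SetLike.mem_coe, LinearMap.mem_ker, hB]
    rcases le_total m m' with h | h
    · exact trace_mul_bracket_of_le h q q' x
    · rw [trace_mul_bracket_comm, trace_mul_bracket_of_le h, neg_zero]
  exact this hu

theorem zSpan_le_ker_bracket {n : ℕ} (x : M n) : zSpan n x ≤ LinearMap.ker (bracket x) := by
  intro w hw
  have := commute_of_mem_zSpan hw
  rw [proj_self, one_mul, mul_one] at this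
  exact mem_ker_bracket.2 this

theorem map_bracket_sSpan_succ {k : ℕ} (x : M (k + 1)) :
    (sSpan (k + 1) x).map (bracket x) = (sSpan k x).map (bracket x) := by
  rw [sSpan_succ, Submodule.map_sup, LinearMap.le_ker_iff_map.1 (zSpan_le_ker_bracket x), sup_bot_eq]

theorem finrank_map_bracket_le {k : ℕ} (x : M (k + 1)) :
    finrank ℂ ((sSpan (k + 1) x).map (bracket x)) ≤ d k := by
  rw [map_bracket_sSpan_succ]
  exact (Submodule.finrank_map_le _ _).trans (finrank_sSpan_le k x)

theorem finrank_map_add_finrank_inf_ker {V W : Type} [AddCommGroup V] [Module ℂ V]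
    [FiniteDimensional ℂ V] [AddCommGroup W] [Module ℂ W] (f : V →ₗ[ℂ] W) (S : Submodule ℂ V) :
    finrank ℂ (S.map f) + finrank ℂ (S ⊓ LinearMap.ker f : Submodule ℂ V) = finrank ℂ S := by
  have h := LinearMap.finrank_range_add_finrank_ker (f.domRestrict S)
  rw [LinearMap.range_domRestrict, LinearMap.ker_domRestrict] at h
  rw [← Submodule.map_comap_subtype, Submodule.finrank_map_subtype_eq]
  exact h

/-- The Hamiltonian vector fields span a space of the maximal dimension at `x` if and only if the
differentials of the functions are independent at `x`. For the harder direction: the sum of the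
algebras `Z_{x,m}`, `m < n`, and of the centralizer of `x` is isotropic for `(u, v) ↦ tr (u [v, x])`,
whose radical is the centralizer, and counting dimensions shows that `x` is regular. -/
theorem finrank_map_bracket_eq_iff {k : ℕ} (x : M (k + 1)) :
    finrank ℂ ((sSpan (k + 1) x).map (bracket x)) = d k ↔
      finrank ℂ (sSpan (k + 1) x) = d (k + 1) := by
  rw [map_bracket_sSpan_succ, finrank_sSpan_succ_eq_iff]
  have hrn := finrank_map_add_finrank_inf_ker (bracket x) (sSpan k x)
  constructor
  · intro h
    have h1 := finrank_sSpan_le k x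
    have hS : finrank ℂ (sSpan k x) = d k := by omega
    have hdisj : sSpan k x ⊓ LinearMap.ker (bracket x) = ⊥ :=
      (Submodule.finrank_eq_zero (R := ℂ)).1 (by omega)
    have htr : ∀ u ∈ sSpan k x ⊔ LinearMap.ker (bracket x),
        ∀ w ∈ (sSpan k x).map (bracket x), (u * w).trace = 0 := by
      intro u' hu' w hw
      obtain ⟨u, hu, c, hc, rfl⟩ := Submodule.mem_sup.1 hu'
      obtain ⟨v, hv, rfl⟩ := hw
      rw [add_mul, Matrix.trace_add, trace_mul_bracket_eq_zero hu hv, zero_add,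
        trace_mul_bracket_comm, LinearMap.mem_ker.1 hc, mul_zero, Matrix.trace_zero, neg_zero]
    have hiso := finrank_add_finrank_le_of_trace_eq_zero htr
    have hsup := Submodule.finrank_sup_add_finrank_inf_eq (sSpan k x) (LinearMap.ker (bracket x))
    rw [hdisj, finrank_bot, hS] at hsup
    rw [h] at hiso
    have hker : finrank ℂ (LinearMap.ker (bracket x)) =
        finrank ℂ (Subalgebra.centralizer ℂ ({x} : Set (M (k + 1)))) := by
      rw [ker_bracket]
      rfl
    have hlow := le_finrank_centralizer x
    have htwo := two_mul_d k
    have hreg : finrank ℂ (Subalgebra.centralizer ℂ ({x} : Set (M (k + 1)))) = k + 1 := by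
      rw [hker] at hsup
      have : (k + 1) * (k + 1) = k * (k + 1) + (k + 1) := by ring
      omega
    refine ⟨hS, (isRegularMatrix_cutoff_iff le_rfl x).1 hreg, ?_⟩
    exact eq_bot_mono (inf_le_inf_left _ (zSpan_le_ker_bracket x)) hdisj
  · rintro ⟨hS, hZ, hinf⟩
    have hdisj : sSpan k x ⊓ LinearMap.ker (bracket x) = ⊥ := by
      rw [eq_bot_iff, ← hinf]
      rintro w ⟨hw, hc⟩
      refine ⟨hw, mem_zSpan_of_commute le_rfl hZ (by rw [proj_self, one_mul])
        (by rw [proj_self, mul_one]) ?_⟩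
      rw [proj_self, one_mul, mul_one]
      exact mem_ker_bracket.1 hc
    rw [hdisj, finrank_bot] at hrn
    omega

end GelfandZeitlin

/-! ### The differentials of the coefficients of the characteristic polynomials -/

namespace GelfandZeitlin

open Module Polynomial

/-- The derivative of the determinant (Jacobi's formula). -/
theorem hasFDerivAt_det {m : ℕ} (y : M m) :
    HasFDerivAt (fun z : M m => z.det) (LinearMap.toContinuousLinearMap
      (traceDual m y.adjugate)) y := by
  let D : ContinuousMultilinearMap ℂ (fun _ : Fin m => Fin m → ℂ) ℂ :=
    { toMultilinearMap := Matrix.detRowAlternating.toMultilinearMap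
      cont := Continuous.matrix_det (A := fun z : Fin m → Fin m → ℂ => Matrix.of z)
        continuous_id }
  let L : M m →L[ℂ] (Fin m → Fin m → ℂ) :=
    LinearMap.toContinuousLinearMap (Matrix.ofLinearEquiv ℂ).symm.toLinearMap
  have h := (D.hasFDerivAt (Matrix.of.symm y)).comp y (f := fun z => L z) L.hasFDerivAt
  refine h.congr_fderiv ?_
  apply ContinuousLinearMap.ext
  intro v
  refine (D.linearDeriv_apply (Matrix.of.symm y) (Matrix.of.symm v)).trans ?_
  change ∑ i, (y.updateRow i (v i)).det = (y.adjugate * v).trace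
  rw [Matrix.trace_mul_comm]
  refine Finset.sum_congr rfl fun i _ => ?_
  rw [← Matrix.cramer_transpose_apply, Matrix.cramer_eq_adjugate_mulVec,
    ← Matrix.adjugate_transpose, Matrix.diag_apply, Matrix.mul_apply]
  simp [Matrix.mulVec, dotProduct, mul_comm]

/-- The coefficient of `X ^ k` in the adjugate of `X - y`. -/
noncomputable def adjCoeff {m : ℕ} (y : M m) (k : ℕ) : M m :=
  Matrix.of fun i j => (y.charmatrix.adjugate i j).coeff k

theorem hasFDerivAt_eval_charpoly {m : ℕ} (y : M m) (t : ℂ) :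
    HasFDerivAt (fun z : M m => z.charpoly.eval t) (-LinearMap.toContinuousLinearMap
      (traceDual m (Matrix.scalar (Fin m) t - y).adjugate)) y := by
  have h1 : HasFDerivAt (fun z : M m => Matrix.scalar (Fin m) t - z)
    (-ContinuousLinearMap.id ℂ (M m)) y := (hasFDerivAt_id y).const_sub _
  have h2 := (hasFDerivAt_det (Matrix.scalar (Fin m) t - y)).comp y
    (f := fun z => Matrix.scalar (Fin m) t - z) h1
  simp only [Matrix.eval_charpoly]
  refine h2.congr_fderiv ?_
  apply ContinuousLinearMap.ext
  intro v
  exact map_neg (traceDual m (Matrix.scalar (Fin m) t - y).adjugate) v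

/-- A coefficient of the characteristic polynomial is a linear combination of its values. -/
theorem differentiableAt_charpoly_coeff {m : ℕ} (y : M m) (k : ℕ) :
    DifferentiableAt ℂ (fun z : M m => z.charpoly.coeff k) y := by
  have hinj : Set.InjOn (fun i : ℕ => (i : ℂ)) (Finset.range (m + 1)) :=
    fun a _ b _ h => Nat.cast_injective h
  have h : ∀ z : M m, z.charpoly.coeff k = ∑ i ∈ Finset.range (m + 1),
      z.charpoly.eval (i : ℂ) *
        (Lagrange.basis (Finset.range (m + 1)) (fun i : ℕ => (i : ℂ)) i).coeff k := by
    intro z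
    have hdeg : z.charpoly.degree < (Finset.range (m + 1)).card := by
      rw [Finset.card_range, degree_eq_natDegree z.charpoly_monic.ne_zero,
        z.charpoly_natDegree_eq_dim, Fintype.card_fin]
      exact_mod_cast Nat.lt_succ_self m
    conv_lhs => rw [Lagrange.eq_interpolate hinj hdeg, Lagrange.interpolate_apply]
    simp [finsetSum_coeff]
  simp only [h]
  exact DifferentiableAt.fun_sum fun i _ =>
    (hasFDerivAt_eval_charpoly y i).differentiableAt.mul_const _

/-- The values of the characteristic polynomial at all `t` are differentiated by Jacobi's formula,
and then the coefficients are compared. -/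
theorem fderiv_charpoly_coeff {m : ℕ} (y : M m) {k : ℕ} (hk : k < m + 1) (v : M m) :
    fderiv ℂ (fun z : M m => z.charpoly.coeff k) y v = -(adjCoeff y k * v).trace := by
  let T : ℂ[X] := -∑ i, ∑ j, y.charmatrix.adjugate i j * C (v j i)
  let D : ℕ → ℂ := fun k => fderiv ℂ (fun z : M m => z.charpoly.coeff k) y v
  have hT : ∑ k ∈ Finset.range (m + 1), C (D k) * X ^ k = T := by
    refine Polynomial.funext fun t => ?_
    have h1 : ∀ z : M m, z.charpoly.eval t =
        ∑ k ∈ Finset.range (m + 1), z.charpoly.coeff k * t ^ k := fun z => by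
      rw [eval_eq_sum_range, z.charpoly_natDegree_eq_dim, Fintype.card_fin]
    have h2 := hasFDerivAt_eval_charpoly y t
    simp only [h1] at h2
    have h3 := HasFDerivAt.fun_sum fun k (_ : k ∈ Finset.range (m + 1)) =>
      (differentiableAt_charpoly_coeff y k).hasFDerivAt.mul_const (t ^ k)
    have h4 := DFunLike.congr_fun (h3.unique h2) v
    have h5 : (Matrix.scalar (Fin m) t - y).adjugate =
        y.charmatrix.adjugate.map (eval t) := by
      have := (evalRingHom t).map_adjugate y.charmatrix
      rw [show (evalRingHom t).mapMatrix y.charmatrix = Matrix.scalar (Fin m) t - y by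
        ext i j
        simp [Matrix.charmatrix_apply, Matrix.diagonal_apply, apply_ite]] at this
      exact this.symm
    rw [h5] at h4
    rw [sum_apply] at h4
    have h6 : ∑ k ∈ Finset.range (m + 1), t ^ k * D k =
        -(y.charmatrix.adjugate.map (eval t) * v).trace := h4
    simp only [T, eval_finsetSum, eval_neg, eval_mul, eval_C, eval_pow, eval_X]
    rw [← Finset.sum_congr rfl fun k _ => mul_comm (t ^ k) (D k), h6]
    simp [Matrix.trace, Matrix.mul_apply]
  have h6 := congrArg (fun p => p.coeff k) hT
  simp only [finsetSum_coeff, coeff_C_mul_X_pow, T, coeff_neg, coeff_mul_C] at h6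
  rw [Finset.sum_ite_eq, if_pos (Finset.mem_range.2 hk)] at h6
  refine h6.trans ?_
  simp [adjCoeff, Matrix.trace, Matrix.mul_apply]

/-- Comparison of coefficients in `(X - y) adj (X - y) = χ_y`. -/
theorem adjCoeff_eq {m : ℕ} (y : M m) (k : ℕ) :
    adjCoeff y k = y * adjCoeff y (k + 1) + y.charpoly.coeff (k + 1) • (1 : M m) := by
  have h := Matrix.mul_adjugate y.charmatrix
  ext i j
  have h1 := congrArg (fun A : Matrix (Fin m) (Fin m) ℂ[X] => (A i j).coeff (k + 1)) h
  have h2 : y.charmatrix = (X : ℂ[X]) • 1 - y.map C := by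
    rw [Matrix.smul_one_eq_diagonal]
    rfl
  beta_reduce at h1
  nth_rw 1 [h2] at h1
  rw [Matrix.sub_mul, Matrix.smul_mul, Matrix.one_mul] at h1
  simp only [Matrix.sub_apply, Matrix.smul_apply, smul_eq_mul, coeff_sub, coeff_X_mul,
    Matrix.mul_apply, finsetSum_coeff, Matrix.map_apply, coeff_C_mul] at h1
  change (y.charmatrix.adjugate i j).coeff k =
    (y * adjCoeff y (k + 1)) i j + y.charpoly.coeff (k + 1) * (1 : Matrix (Fin m) (Fin m) ℂ) i j
  rw [Matrix.mul_apply]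
  rw [sub_eq_iff_eq_add] at h1
  rw [h1, add_comm]
  congr 1
  change (y.charpoly * (1 : Matrix (Fin m) (Fin m) ℂ[X]) i j).coeff (k + 1) = _
  simp only [Matrix.one_apply]
  split_ifs <;> simp

/-- The recursion `adjCoeff_eq` loses its constant term for `m ≤ k`, and the coefficients vanish for
large `k`. -/
theorem adjCoeff_eq_zero {m : ℕ} (y : M m) {k : ℕ} (hk : m ≤ k) : adjCoeff y k = 0 := by
  obtain ⟨N, hN⟩ : ∃ N, ∀ k, N ≤ k → adjCoeff y k = 0 := by
    refine ⟨(∑ i, ∑ j, (y.charmatrix.adjugate i j).natDegree) + 1, fun k hk => ?_⟩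
    ext i j
    refine coeff_eq_zero_of_natDegree_lt (lt_of_le_of_lt ?_ (Nat.lt_of_succ_le hk))
    exact (Finset.single_le_sum (f := fun j => (y.charmatrix.adjugate i j).natDegree)
      (fun _ _ => Nat.zero_le _) (Finset.mem_univ j)).trans
      (Finset.single_le_sum (f := fun i => ∑ j, (y.charmatrix.adjugate i j).natDegree)
      (fun _ _ => Nat.zero_le _) (Finset.mem_univ i))
  have h : ∀ l k, m ≤ k → N ≤ k + l → adjCoeff y k = 0 := by
    intro l
    induction l with
    | zero => exact fun k _ h => hN k h
    | succ l ih =>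
      intro k hk hl
      rw [adjCoeff_eq, ih (k + 1) (by omega) (by omega), coeff_eq_zero_of_natDegree_lt]
      · simp
      · rw [y.charpoly_natDegree_eq_dim, Fintype.card_fin]
        omega
  exact h N k hk (by omega)

theorem adjCoeff_sub_pow_mem {m : ℕ} (y : M m) (j : ℕ) (hj : j < m) :
    adjCoeff y (m - 1 - j) - y ^ j ∈ Submodule.span ℂ {z | ∃ q < j, z = y ^ q} := by
  induction j with
  | zero =>
    rw [adjCoeff_eq, adjCoeff_eq_zero y (by omega), show m - 1 - 0 + 1 = m by omega]
    have h := y.charpoly_monic.coeff_natDegree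
    rw [y.charpoly_natDegree_eq_dim, Fintype.card_fin] at h
    simp [h]
  | succ j ih =>
    have h1 := ih (by omega)
    rw [adjCoeff_eq, show m - 1 - (j + 1) + 1 = m - 1 - j by omega, add_sub_right_comm, pow_succ',
      ← mul_sub]
    refine Submodule.add_mem _ ?_ (Submodule.smul_mem _ _ (Submodule.subset_span
      ⟨0, by omega, (pow_zero y).symm⟩))
    have h2 : Submodule.span ℂ {z | ∃ q < j, z = y ^ q} ≤
        (Submodule.span ℂ {z | ∃ q < j + 1, z = y ^ q}).comap (LinearMap.mulLeft ℂ y) := by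
      refine Submodule.span_le.2 ?_
      rintro _ ⟨q, hq, rfl⟩
      exact Submodule.subset_span ⟨q + 1, by omega, (pow_succ' y q).symm⟩
    exact h2 h1

/-- The coefficients of `adj (X - y)` and the powers of `y` differ by a unitriangular change of
basis. -/
theorem span_adjCoeff {m : ℕ} (y : M m) :
    Submodule.span ℂ {z | ∃ k < m, z = adjCoeff y k} =
      Submodule.span ℂ {z | ∃ q < m, z = y ^ q} := by
  apply le_antisymm
  · refine Submodule.span_le.2 ?_
    rintro _ ⟨k, hk, rfl⟩
    have h := adjCoeff_sub_pow_mem y (m - 1 - k) (by omega)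
    rw [show m - 1 - (m - 1 - k) = k by omega] at h
    have h1 : y ^ (m - 1 - k) ∈ Submodule.span ℂ {z | ∃ q < m, z = y ^ q} :=
      Submodule.subset_span ⟨_, by omega, rfl⟩
    rw [SetLike.mem_coe, ← sub_add_cancel (adjCoeff y k) (y ^ (m - 1 - k))]
    refine Submodule.add_mem _ (Submodule.span_mono ?_ h) h1
    rintro _ ⟨q, hq, rfl⟩
    exact ⟨q, by omega, rfl⟩
  · refine Submodule.span_le.2 ?_
    rintro _ ⟨q, hq, rfl⟩
    induction q using Nat.strong_induction_on with
    | _ q ih =>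
      have h := adjCoeff_sub_pow_mem y q hq
      have h1 : adjCoeff y (m - 1 - q) ∈ Submodule.span ℂ {z | ∃ k < m, z = adjCoeff y k} :=
        Submodule.subset_span ⟨_, by omega, rfl⟩
      rw [SetLike.mem_coe, ← sub_sub_cancel (adjCoeff y (m - 1 - q)) (y ^ q)]
      refine Submodule.sub_mem _ h1 (Submodule.span_le.2 ?_ h)
      rintro _ ⟨r, hr, rfl⟩
      exact ih r hr (by omega)

/-- The cutoff as a continuous linear map. -/
noncomputable def cutoffL {m n : ℕ} (h : m ≤ n) : M n →L[ℂ] M m :=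
  LinearMap.toContinuousLinearMap
    { toFun := cutoff h
      map_add' := fun _ _ => rfl
      map_smul' := fun _ _ => rfl }

theorem cutoffL_apply {m n : ℕ} (h : m ≤ n) (x : M n) : cutoffL h x = cutoff h x := rfl

theorem fderiv_gzFun {m n : ℕ} (h : m ≤ n) (k : Fin m) (x : M n) :
    (fderiv ℂ (gzFun h k) x : M n →ₗ[ℂ] ℂ) =
      (-(-1) ^ (m - (k : ℕ)) : ℂ) • traceDual n (corner n (adjCoeff (cutoff h x) k)) := by
  have h1 := (differentiableAt_charpoly_coeff (cutoff h x) k).hasFDerivAt.comp x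
    (f := fun z => cutoffL h z) (cutoffL h).hasFDerivAt
  have h2 := (h1.const_mul ((-1) ^ (m - (k : ℕ)))).fderiv
  refine LinearMap.ext fun v => ?_
  have h3 : fderiv ℂ (gzFun h k) x = _ := h2
  rw [ContinuousLinearMap.coe_coe, h3]
  change (-1) ^ (m - (k : ℕ)) * fderiv ℂ (fun z : M m => z.charpoly.coeff k) (cutoff h x)
    (cutoffL h v) = _
  rw [fderiv_charpoly_coeff _ (by omega), LinearMap.smul_apply, traceDual_apply,
    trace_corner_mul h, cutoffL_apply, smul_eq_mul]
  ring

theorem card_index (n : ℕ) : Fintype.card ((m : Fin n) × Fin ((m : ℕ) + 1)) = d n := by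
  rw [Fintype.card_sigma]
  simp only [Fintype.card_fin]
  rw [Fin.sum_univ_eq_sum_range (fun i => i + 1)]
  induction n with
  | zero => rfl
  | succ n ih => rw [Finset.sum_range_succ, ih, d_succ]

theorem span_fderiv_gzFun {n : ℕ} (x : M n) :
    (Submodule.span ℂ (Set.range fun i : (m : Fin n) × Fin ((m : ℕ) + 1) =>
      fderiv ℂ (gzFun (Nat.succ_le_of_lt i.1.isLt) i.2 : M n → ℂ) x)).map
        (ContinuousLinearMap.coeLM ℂ) = (sSpan n x).map (traceDual n) := by
  rw [Submodule.map_span]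
  have hcoe : ∀ f : M n →L[ℂ] ℂ, ContinuousLinearMap.coeLM ℂ f = (f : M n →ₗ[ℂ] ℂ) :=
    fun _ => rfl
  apply le_antisymm
  · refine Submodule.span_le.2 ?_
    rintro _ ⟨_, ⟨⟨m, k⟩, rfl⟩, rfl⟩
    rw [SetLike.mem_coe, hcoe, fderiv_gzFun]
    refine Submodule.smul_mem _ _ ⟨_, ?_, rfl⟩
    have hm : (m : ℕ) + 1 ≤ n := m.isLt
    have h1 : adjCoeff (cutoff hm x) k ∈
        Subalgebra.toSubmodule (Algebra.adjoin ℂ {cutoff hm x}) := by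
      rw [adjoin_eq_span_pow, ← span_adjCoeff]
      exact Submodule.subset_span ⟨k, k.2, rfl⟩
    have h2 : corner n (adjCoeff (cutoff hm x) k) ∈ zSpan ((m : ℕ) + 1) x := by
      rw [zSpan_eq_map hm]
      exact ⟨_, h1, rfl⟩
    refine Submodule.span_mono ?_ h2
    rintro _ ⟨q, hq, rfl⟩
    exact ⟨_, hm, q, hq, rfl⟩
  · rw [Submodule.map_le_iff_le_comap]
    refine Submodule.span_le.2 ?_
    rintro _ ⟨m, hm, q, hq, rfl⟩
    obtain ⟨l, rfl⟩ : ∃ l, m = l + 1 := ⟨m - 1, by omega⟩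
    rw [cutPow_proj hm]
    have h1 : Submodule.span ℂ {z | ∃ k < l + 1, z = adjCoeff (cutoff hm x) k} ≤
        ((Submodule.span ℂ (ContinuousLinearMap.coeLM ℂ '' Set.range
          fun i : (m : Fin n) × Fin ((m : ℕ) + 1) =>
          fderiv ℂ (gzFun (Nat.succ_le_of_lt i.1.isLt) i.2 : M n → ℂ) x)).comap
            (traceDual n)).comap (cornerHom hm : M (l + 1) →ₗ[ℂ] M n) := by
      refine Submodule.span_le.2 ?_
      rintro _ ⟨k, hk, rfl⟩
      have h2 := fderiv_gzFun hm ⟨k, hk⟩ x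
      have h3 : (-(-1) ^ (l + 1 - k) : ℂ) ≠ 0 := by simp
      rw [SetLike.mem_coe, Submodule.mem_comap, Submodule.mem_comap,
        ← Submodule.smul_mem_iff _ h3]
      refine Submodule.subset_span ⟨_, ⟨⟨⟨l, hm⟩, ⟨k, hk⟩⟩, rfl⟩, ?_⟩
      exact h2
    rw [span_adjCoeff] at h1
    exact h1 (Submodule.subset_span ⟨q, hq, rfl⟩)

theorem isStronglyRegular_iff {n : ℕ} (x : M n) :
    IsStronglyRegular x ↔ finrank ℂ (sSpan n x) = d n := by
  rw [IsStronglyRegular, linearIndependent_iff_card_eq_finrank_span, card_index, Set.finrank]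
  have h1 := span_fderiv_gzFun x
  have h2 := (Submodule.equivMapOfInjective _ (traceDual_injective n) (sSpan n x)).finrank_eq
  rw [h2, ← h1]
  rw [← (Submodule.equivMapOfInjective _ ContinuousLinearMap.coe_injective
    (Submodule.span ℂ (Set.range fun i : (m : Fin n) × Fin ((m : ℕ) + 1) =>
      fderiv ℂ (gzFun (Nat.succ_le_of_lt i.1.isLt) i.2 : M n → ℂ) x))).finrank_eq]
  exact eq_comm

end GelfandZeitlin

namespace GelfandZeitlin

open Module

/-! ### The Hamiltonian vector fields of the functions `f_{(k,m)}` -/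

theorem trace_mul_single_one {n : ℕ} (G : M n) (i j : Fin n) :
    (G * Matrix.single i j 1).trace = G j i := by
  simp [Matrix.trace, Matrix.mul_apply, Matrix.single_apply, ite_and]

/-- If the gradient of `φ` with respect to the trace form is `G`, then `ξ_φ = [G, x]`. -/
theorem hamiltonianField_eq_bracket {n : ℕ} {φ : M n → ℂ} {x G : M n}
    (h : ∀ v, fderiv ℂ φ x v = (G * v).trace) : hamiltonianField φ x = bracket x G := by
  have hcoord : ∀ (s t : Fin n) (v : M n), fderiv ℂ (fun y : M n => y s t) x v = v s t := by
    intro s t v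
    have := (LinearMap.toContinuousLinearMap (Matrix.entryLinearMap ℂ ℂ s t)).hasFDerivAt (x := x)
    exact DFunLike.congr_fun this.fderiv v
  ext s t
  change poisson φ (fun y => y s t) x = (G * x) s t - (x * G) s t
  simp only [poisson, h, hcoord, trace_mul_single_one, Matrix.single_apply, ite_and]
  simp [Matrix.mul_apply, mul_sub, Finset.sum_sub_distrib, mul_comm]

/-- The derivative of a power is a sum over positions; under the trace against a power of `y` all
positions count the same. -/
theorem exists_hasFDerivAt_pow {m : ℕ} (y : M m) (p : ℕ) :
    ∃ L : M m →L[ℂ] M m, HasFDerivAt (fun z : M m => z ^ (p + 1)) L y ∧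
      ∀ v j, (y ^ j * L v).trace = (p + 1) * (y ^ (j + p) * v).trace := by
  induction p with
  | zero =>
    refine ⟨ContinuousLinearMap.id ℂ (M m), ?_, fun v j => by simp⟩
    simp only [zero_add, pow_one]
    exact hasFDerivAt_id y
  | succ p ih =>
    obtain ⟨L, hL, htr⟩ := ih
    have h1 := hL.mul' (hasFDerivAt_id (𝕜 := ℂ) y)
    have h2 : (fun z : M m => z ^ (p + 1)) * id = fun z : M m => z ^ (p + 1 + 1) :=
      funext fun z => (pow_succ z (p + 1)).symm
    rw [h2] at h1
    refine ⟨_, h1, fun v j => ?_⟩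
    change (y ^ j * (y ^ (p + 1) * v + L v * y)).trace = _
    rw [mul_add, Matrix.trace_add, ← mul_assoc, ← mul_assoc, ← pow_add,
      Matrix.trace_mul_comm (y ^ j * L v), ← mul_assoc, ← pow_succ', htr,
      show j + 1 + p = j + (p + 1) by ring]
    push_cast
    ring

theorem fderiv_gzTrace {m n : ℕ} (h : m ≤ n) (k : Fin m) (x v : M n) :
    fderiv ℂ (gzTrace h k) x v = (cutPow (proj n m) (m - 1 - k) x * v).trace := by
  obtain ⟨L, hL, htr⟩ := exists_hasFDerivAt_pow (cutoff h x) (m - 1 - k)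
  let T : M m →L[ℂ] ℂ := LinearMap.toContinuousLinearMap (Matrix.traceLinearMap (Fin m) ℂ ℂ)
  have h1 := hL.comp x (f := fun z => cutoffL h z) (cutoffL h).hasFDerivAt
  have h2 := (T.hasFDerivAt.comp x h1).const_mul ((m - (k : ℕ) : ℕ) : ℂ)⁻¹
  have hk : m - 1 - (k : ℕ) + 1 = m - k := by omega
  rw [hk] at h2
  have h3 : fderiv ℂ (gzTrace h k) x = _ := h2.fderiv
  rw [h3]
  change ((m - (k : ℕ) : ℕ) : ℂ)⁻¹ * (L (cutoff h v)).trace = _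
  have h4 := htr (cutoff h v) 0
  have h5 : ((m - (k : ℕ) : ℕ) : ℂ) ≠ 0 := by
    rw [← hk]
    exact Nat.cast_ne_zero.2 (Nat.succ_ne_zero _)
  rw [pow_zero, one_mul, zero_add] at h4
  rw [cutPow_proj h, trace_corner_mul h, h4, ← Nat.cast_add_one, hk, inv_mul_cancel_left₀ h5]

theorem hamiltonianField_gzTrace {m n : ℕ} (h : m ≤ n) (k : Fin m) (x : M n) :
    hamiltonianField (gzTrace h k) x = bracket x (cutPow (proj n m) (m - 1 - k) x) :=
  hamiltonianField_eq_bracket (fderiv_gzTrace h k x)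

/-! ### The orbits -/

/-- The flows of the vector fields `x ↦ [x_m ^ q, x]` commute, so they combine to an action of
a vector space. The fields with `m = n` are included, as in `gzFields`, although they vanish. -/
theorem exists_gzAction (n : ℕ) :
    ∃ Φ : HolomorphicAction ((m : Fin n) × Fin ((m : ℕ) + 1) → ℂ) (M n),
      ∀ x a, Φ.field x a =
        ∑ i, a i • bracket x (cutPow (proj n ((i.1 : ℕ) + 1)) i.2 x) := by
  obtain ⟨Φ, hΦ⟩ := HolomorphicAction.exists_of_commuting
    (fun i : (m : Fin n) × Fin ((m : ℕ) + 1) =>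
      cutFlow (proj n ((i.1 : ℕ) + 1)) (proj_mul_self n _) i.2) (by
    intro i j s t x
    rcases le_total ((i.1 : ℕ) + 1) ((j.1 : ℕ) + 1) with h | h
    · exact cutFlow_comm _ _ (proj_mul_proj_of_le h) (proj_mul_proj_of_ge h) _ _ _ _ _
    · exact (cutFlow_comm _ _ (proj_mul_proj_of_le h) (proj_mul_proj_of_ge h) _ _ _ _ _).symm)
  refine ⟨Φ, fun x a => ?_⟩
  rw [hΦ]
  simp only [cutFlow_field_one, bracket_apply]

section Orbit

variable {n : ℕ} {Φ : HolomorphicAction ((m : Fin n) × Fin ((m : ℕ) + 1) → ℂ) (M n)}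
  (hΦ : ∀ x a, Φ.field x a = ∑ i, a i • bracket x (cutPow (proj n ((i.1 : ℕ) + 1)) i.2 x))
include hΦ

theorem field_single (x : M n) (i : (m : Fin n) × Fin ((m : ℕ) + 1)) :
    Φ.field x (Pi.single i 1) = bracket x (cutPow (proj n ((i.1 : ℕ) + 1)) i.2 x) := by
  rw [hΦ, Finset.sum_eq_single i]
  · simp
  · intro j _ hj
    simp [Pi.single_eq_of_ne hj]
  · simp

theorem range_field (x : M n) :
    LinearMap.range (Φ.field x : ((m : Fin n) × Fin ((m : ℕ) + 1) → ℂ) →ₗ[ℂ] M n) = (sSpan n x).map (bracket x) := by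
  apply le_antisymm
  · rintro _ ⟨a, rfl⟩
    rw [ContinuousLinearMap.coe_coe, hΦ]
    refine Submodule.sum_mem _ fun i _ => Submodule.smul_mem _ _ ⟨_, ?_, rfl⟩
    exact Submodule.subset_span ⟨_, i.1.isLt, _, i.2.isLt, rfl⟩
  · rw [Submodule.map_le_iff_le_comap]
    refine Submodule.span_le.2 ?_
    rintro _ ⟨m, hm, q, hq, rfl⟩
    obtain ⟨l, rfl⟩ : ∃ l, m = l + 1 := ⟨m - 1, by omega⟩
    exact ⟨Pi.single ⟨⟨l, hm⟩, ⟨q, hq⟩⟩ 1, field_single hΦ x ⟨⟨l, hm⟩, ⟨q, hq⟩⟩⟩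

theorem mem_gzFields_iff (ξ : M n → M n) :
    ξ ∈ gzFields n ↔ ∃ a, ξ = fun x => Φ.field x a := by
  constructor
  · intro hξ
    induction hξ using Submodule.span_induction with
    | mem ξ h =>
      obtain ⟨m, hm, k, rfl⟩ := h
      obtain ⟨l, rfl⟩ : ∃ l, m = l + 1 := ⟨m - 1, by have := k.isLt; omega⟩
      refine ⟨Pi.single ⟨⟨l, hm⟩, ⟨l + 1 - 1 - k, by simp only; omega⟩⟩ 1, ?_⟩
      funext x
      rw [field_single hΦ, hamiltonianField_gzTrace]
    | zero => exact ⟨0, by funext x; simp⟩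
    | add ξ η _ _ hξ hη =>
      obtain ⟨a, rfl⟩ := hξ
      obtain ⟨b, rfl⟩ := hη
      exact ⟨a + b, by funext x; simp⟩
    | smul c ξ _ hξ =>
      obtain ⟨a, rfl⟩ := hξ
      exact ⟨c • a, by funext x; simp⟩
  · rintro ⟨a, rfl⟩
    have h : (fun x => Φ.field x a) =
        ∑ i, a i • fun x => bracket x (cutPow (proj n ((i.1 : ℕ) + 1)) i.2 x) := by
      funext x
      simp [hΦ]
    rw [h]
    refine Submodule.sum_mem _ fun i _ => Submodule.smul_mem _ _ (Submodule.subset_span ?_)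
    have hlt := i.2.isLt
    refine ⟨(i.1 : ℕ) + 1, i.1.isLt, ⟨(i.1 : ℕ) - i.2, by omega⟩, ?_⟩
    funext x
    rw [hamiltonianField_gzTrace]
    congr 2
    simp only
    omega

theorem mem_gzGroup_iff (σ : Equiv.Perm (M n)) : σ ∈ gzGroup n ↔ ∃ a, σ = Φ.perm a := by
  constructor
  · intro hσ
    induction hσ using Subgroup.closure_induction with
    | mem σ h =>
      obtain ⟨ξ, hξ, hσ⟩ := h
      obtain ⟨a, rfl⟩ := (mem_gzFields_iff hΦ ξ).1 hξ
      refine ⟨a, Equiv.ext fun y => ?_⟩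
      obtain ⟨γ, hγ, h0, h1⟩ := hσ y
      rw [← h1, Φ.eq_of_hasDerivAt hγ 1, one_smul, h0, Φ.perm_apply]
    | one => exact ⟨0, Equiv.ext fun y => (Φ.act_zero y).symm⟩
    | mul σ τ _ _ hσ hτ =>
      obtain ⟨a, rfl⟩ := hσ
      obtain ⟨b, rfl⟩ := hτ
      exact ⟨a + b, Equiv.ext fun y => (Φ.act_add a b y).symm⟩
    | inv σ _ hσ =>
      obtain ⟨a, rfl⟩ := hσ
      exact ⟨-a, Equiv.ext fun y => rfl⟩
  · rintro ⟨a, rfl⟩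
    refine Subgroup.subset_closure ⟨_, (mem_gzFields_iff hΦ _).2 ⟨a, rfl⟩, fun y => ?_⟩
    exact ⟨fun t => Φ.act (t • a) y, Φ.hasDerivAt_smul a y, by simp [Φ.act_zero], by simp⟩

theorem gzOrbit_eq_range (x : M n) : gzOrbit x = Set.range fun a => Φ.act a x := by
  ext y
  constructor
  · rintro ⟨⟨σ, hσ⟩, rfl⟩
    obtain ⟨a, rfl⟩ := (mem_gzGroup_iff hΦ σ).1 hσ
    exact ⟨a, rfl⟩
  · rintro ⟨a, rfl⟩
    exact ⟨⟨Φ.perm a, (mem_gzGroup_iff hΦ _).2 ⟨a, rfl⟩⟩, rfl⟩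

end Orbit

theorem isComplexSubmanifold_gzOrbit {n : ℕ} (x : M n) :
    IsComplexSubmanifold (gzOrbit x) (finrank ℂ ((sSpan n x).map (bracket x))) := by
  obtain ⟨Φ, hΦ⟩ := exists_gzAction n
  rw [gzOrbit_eq_range hΦ, ← range_field hΦ]
  exact Φ.isComplexSubmanifold_range x

theorem isComplexSubmanifold_gzOrbit_iff {n : ℕ} (x : M n) (r : ℕ) :
    IsComplexSubmanifold (gzOrbit x) r ↔ finrank ℂ ((sSpan n x).map (bracket x)) = r := by
  constructor
  · exact fun h => (isComplexSubmanifold_gzOrbit x).dim_unique h ⟨x, MulAction.mem_orbit_self x⟩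
  · rintro rfl
    exact isComplexSubmanifold_gzOrbit x

/-! ### The shift matrix is strongly regular -/

/-- The nilpotent Jordan block, with the ones below the diagonal. -/
def shift (n : ℕ) : M n := Matrix.of fun i j => if (i : ℕ) = j + 1 then 1 else 0

theorem cutPow_shift (n m q : ℕ) (i j : Fin n) :
    cutPow (proj n m) q (shift n) i j = if (i : ℕ) = j + q ∧ (i : ℕ) < m then 1 else 0 := by
  have hP : ∀ i j, (proj n m * shift n * proj n m) i j =
      if (i : ℕ) = j + 1 ∧ (i : ℕ) < m then 1 else 0 := by
    intro i j
    rw [proj_eq_diagonal, Matrix.mul_diagonal, Matrix.diagonal_mul]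
    simp only [shift, Matrix.of_apply]
    split_ifs <;> first | (exfalso; omega) | simp
  induction q generalizing i j with
  | zero =>
    rw [cutPow, pow_zero, mul_one, proj_eq_diagonal, Matrix.diagonal_apply]
    simp only [Fin.ext_iff, add_zero]
    split_ifs <;> first | rfl | omega
  | succ q ih =>
    have h1 : cutPow (proj n m) (q + 1) (shift n) =
        cutPow (proj n m) q (shift n) * (proj n m * shift n * proj n m) := by
      rw [cutPow, pow_succ, ← mul_assoc]
      rfl
    rw [h1, Matrix.mul_apply]
    simp only [ih, hP]
    split_ifs with h
    · rw [Finset.sum_eq_single ⟨j + 1, by omega⟩]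
      · rw [if_pos ⟨by simp only; omega, h.2⟩, if_pos ⟨rfl, by simp only; omega⟩, one_mul]
      · intro l _ hl
        rw [if_neg (c := (l : ℕ) = j + 1 ∧ _) fun h' => hl (Fin.ext h'.1), mul_zero]
      · simp
    · refine Finset.sum_eq_zero fun l _ => ?_
      split_ifs <;> first | (exfalso; omega) | simp

/-- The elements of `Z_{x,m}` for the shift `x` are Toeplitz matrices in the corner `M m`. -/
theorem exists_toeplitz_of_mem_zSpan_shift {n m : ℕ} {w : M n} (hw : w ∈ zSpan m (shift n)) :
    ∃ c : ℕ → ℂ, ∀ i j : Fin n,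
      w i j = if (j : ℕ) ≤ i ∧ (i : ℕ) < m then c ((i : ℕ) - j) else 0 := by
  induction hw using Submodule.span_induction with
  | mem z hz =>
    obtain ⟨q, -, rfl⟩ := hz
    refine ⟨Pi.single q 1, fun i j => ?_⟩
    rw [cutPow_shift, Pi.single_apply]
    split_ifs <;> first | rfl | (exfalso; omega)
  | zero => exact ⟨0, fun i j => by simp⟩
  | add y z _ _ hy hz =>
    obtain ⟨a, ha⟩ := hy
    obtain ⟨b, hb⟩ := hz
    refine ⟨a + b, fun i j => ?_⟩
    rw [Matrix.add_apply, ha, hb]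
    split_ifs <;> simp
  | smul c z _ hz =>
    obtain ⟨a, ha⟩ := hz
    refine ⟨c • a, fun i j => ?_⟩
    rw [Matrix.smul_apply, ha]
    split_ifs <;> simp

theorem finrank_sSpan_shift (n : ℕ) : finrank ℂ (sSpan n (shift n)) = d n := by
  refine (finrank_sSpan_eq_iff _).2 ⟨fun m hm h1 => ?_, fun m hm h1 => ?_⟩
  · rw [zSpan_eq_span_range, finrank_span_eq_card, Fintype.card_fin]
    rw [Fintype.linearIndependent_iff]
    intro g hg q
    have h2 := congrArg (fun w : M n => w ⟨q, by omega⟩ ⟨0, by omega⟩) hg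
    simp only [Matrix.sum_apply, Matrix.smul_apply, cutPow_shift, Matrix.zero_apply] at h2
    rw [Finset.sum_eq_single q] at h2
    · simpa using h2
    · intro r _ hr
      rw [if_neg fun h => hr (Fin.ext (by simpa using h.1.symm)), smul_zero]
    · simp
  · rw [eq_bot_iff]
    rintro w ⟨hw1, hw2⟩
    obtain ⟨a, ha⟩ := exists_toeplitz_of_mem_zSpan_shift hw1
    obtain ⟨b, hb⟩ := exists_toeplitz_of_mem_zSpan_shift hw2
    -- the last row of `w` vanishes, and a Toeplitz matrix is determined by it
    have hb0 : ∀ q ≤ m, b q = 0 := by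
      intro q hq
      have h2 := (hb ⟨m, by omega⟩ ⟨m - q, by omega⟩).symm.trans (ha _ _)
      simp only at h2
      rw [if_pos (by omega), if_neg (by omega), Nat.sub_sub_self hq] at h2
      exact h2
    rw [Submodule.mem_bot]
    ext i j
    rw [hb, Matrix.zero_apply]
    split_ifs with h
    · exact hb0 _ (by omega)
    · rfl

end GelfandZeitlin

theorem theorem2p14 (n : ℕ) (hn : 1 ≤ n) :
    (∀ x : M n, ∃ r, IsComplexSubmanifold (gzOrbit x) r) ∧
    IsGreatest {r | ∃ x : M n, IsComplexSubmanifold (gzOrbit x) r} (d (n - 1)) ∧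
    ∀ x : M n, List.TFAE [
      IsStronglyRegular x,
      IsComplexSubmanifold (gzOrbit x) (d (n - 1)),
      (∀ (m : ℕ) (h : m ≤ n), 1 ≤ m → IsRegularMatrix (cutoff h x)) ∧
        (∀ (m : ℕ) (h : m + 1 ≤ n), 1 ≤ m → Z (Nat.le_of_succ_le h) x ⊓ Z h x = ⊥),
      (∀ (m : ℕ) (h : m ≤ n), 1 ≤ m → Module.finrank ℂ (Z h x) = m) ∧
        (∀ (m : ℕ) (h : m + 1 ≤ n), 1 ≤ m → Z (Nat.le_of_succ_le h) x ⊓ Z h x = ⊥)] := by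
  obtain ⟨k, rfl⟩ : ∃ k, n = k + 1 := ⟨n - 1, by omega⟩
  rw [Nat.add_sub_cancel]
  refine ⟨fun x => ⟨_, isComplexSubmanifold_gzOrbit x⟩, ⟨⟨shift (k + 1), ?_⟩, ?_⟩, fun x => ?_⟩
  · rw [isComplexSubmanifold_gzOrbit_iff, finrank_map_bracket_eq_iff]
    exact finrank_sSpan_shift (k + 1)
  · rintro r ⟨x, hx⟩
    rw [isComplexSubmanifold_gzOrbit_iff] at hx
    exact hx ▸ finrank_map_bracket_le x
  · tfae_have 1 ↔ 2 := by
      rw [isComplexSubmanifold_gzOrbit_iff, finrank_map_bracket_eq_iff, isStronglyRegular_iff]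
    tfae_have 1 ↔ 4 := by
      rw [isStronglyRegular_iff, finrank_sSpan_eq_iff]
      simp only [finrank_Z, Z_inf_Z_eq_bot_iff]
    tfae_have 3 ↔ 4 := by
      simp only [finrank_Z, isRegularMatrix_cutoff_iff]
    tfae_finish
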